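/- A function $G:\mathbb{R}\to\mathbb{R}_+$ has property $\mathcal{P}$ if: (1) $G$ is nonzero, nondecreasing and convex on $[0,\infty)$; (2) $G(0)=0$, $G(1)=1$, $G(x)=G(-x)$ for all $x$; (3) there is $s>0$ with $G(x)=sx+(1-s)$ for all $x>1$; (4) $G$ is twice differentiable on $(0,\delta_G)$ for some $\delta_G>0$, the right derivative $G'_+(0)$ exists, $G''_+(0)=\lim_{h\to0^+}(G'(h)-G'_+(0))/h$ exists (the value $+\infty$ is allowed), and $G'_+(0)>0$ or $G''_+(0)>0$; (5) there is $C_G>0$ with $G(x)>0$ and $G(y)/G(x)\le C_G(y/x)^2$ for all $0<x<y$. For $y\in\mathbb{R}^n$ let $\|y\|_G=\inf\{\alpha>0 : \sum_{i=1}^n G(|y_i|/\alpha)\le 1\}$. **Theorem.** There are absolute constants $c_1,c_2,\kappa_1,\kappa_2>0$, and for every $G$ with property $\mathcal{P}$ there are constants $\alpha'_G,\alpha''_G\ge1$ depending only on $G$, such that the following holds for all $n\ge 2$, $1\le d\le n$, all $A\in\mathbb{R}^{n\times d}$ and all integers $t_1\ge c_1d^2$, $t_2\ge c_2d$. Let $D\in\mathbb{R}^{n\times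 n}$ be diagonal with i.i.d. diagonal entries of distribution function $t\mapsto 1-e^{-G(t)}$ for $t\ge0$ (and $0$ for $t<0$). Let $\Pi_1=\Phi Y\in\mathbb{R}^{t_1\times n}$, where $Y$ is diagonal with independent uniform $\pm1$ diagonal entries, and $\Phi_{h(i),i}=1$ for $i\in[n]$ with all other entries of $\Phi$ equal to $0$, for independent uniform $h(1),\dots,h(n)\in[t_1]$. Let $\Pi_2\in\mathbb{R}^{t_2\times t_1}$ have i.i.d. standard Gaussian entries scaled by $1/\sqrt{t_2}$. All these random variables are independent. Then with probability at least $0.9$, for all $x\in\mathbb{R}^d$, $$\frac{\kappa_1}{\alpha'_G\,d\log n}\,\|Ax\|_G\;\le\;\|\Pi_2\Pi_1D^{-1}Ax\|_2\;\le\;\kappa_2\,\alpha''_G\,d^2\log n\;\|Ax\|_G .$$ Furthermore, if $t_1,t_2\le\mathrm{poly}(d)$ (for instance $t_1=\Theta(d^2)$, $t_2=\Theta(d)$), the product $\Pi_2\Pi_1D^{-1}A$ can be computed in $O(\mathrm{nnz}(A))+\mathrm{poly}(d)$ time: there are a single real-RAM program (independent of all data, sizes included) and a constant $K$ such that for every polynomial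 $p$ there is a polynomial $q$ such that, whenever $t_1,t_2\le p(d)$, for every $A\in\mathbb{R}^{n\times d}$ (given as the list of its nonzero entries, in any order), every invertible diagonal $D$ (given by its diagonal), every $\Pi_1$ (given by $h$ and the signs) and every $\Pi_2\in\mathbb{R}^{t_2\times t_1}$ (given by its entries), the program outputs all entries of $\Pi_2\Pi_1D^{-1}A$ after at most $K\,\mathrm{nnz}(A)+q(d)$ steps. Here $\mathrm{nnz}(A)$ is the number of nonzero entries of $A$. The real RAM has arrays of natural numbers and of reals with indirect addressing; each of the following is one step: an addition or truncated subtraction of natural numbers, an operation $+,-,\times,/$ on reals, a load, a store, loading a constant (natural or rational), a comparison. -/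

import Mathlib

open MeasureTheory ProbabilityTheory Filter Topology

/-! ### Orlicz norms -/

/-- The Orlicz norm `‖x‖_G = inf {α > 0 | ∑ i, G (|x i| / α) ≤ 1}`. -/
noncomputable def orliczNorm {n : ℕ} (G : ℝ → ℝ) (x : Fin n → ℝ) : ℝ :=
  sInf {α : ℝ | 0 < α ∧ ∑ i, G (|x i| / α) ≤ 1}

/-- Property `𝒫` of a function `G : ℝ → ℝ₊`. -/
structure PropertyP (G : ℝ → ℝ) : Prop where
  nonneg : ∀ x, 0 ≤ G x
  monotone : MonotoneOn G (Set.Ici 0)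
  convex : ConvexOn ℝ (Set.Ici 0) G
  map_zero : G 0 = 0
  map_one : G 1 = 1
  even : ∀ x, G x = G (-x)
  linear : ∃ s : ℝ, 0 < s ∧ ∀ x, 1 < x → G x = s * x + (1 - s)
  twice_differentiable : ∃ δ : ℝ, 0 < δ ∧ DifferentiableOn ℝ G (Set.Ioo 0 δ) ∧
    DifferentiableOn ℝ (deriv G) (Set.Ioo 0 δ)
  /-- `G'₊(0) = g₁` and `G''₊(0) = g₂` exist and at least one of them is positive. The second
  derivative is a limit in the extended reals: it is `+∞` for `G x = |x| ^ p` near `0` if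
  `1 < p < 2`. -/
  deriv_at_zero : ∃ (g₁ : ℝ) (g₂ : EReal), HasDerivWithinAt G g₁ (Set.Ici 0) 0 ∧
    Tendsto (fun h : ℝ => (((deriv G h - g₁) / h : ℝ) : EReal)) (𝓝[>] 0) (𝓝 g₂) ∧
    (0 < g₁ ∨ 0 < g₂)
  growth : ∃ C : ℝ, 0 < C ∧ ∀ x y, 0 < x → x < y → 0 < G x ∧ G y / G x ≤ C * (y / x) ^ 2

/-! ### The random matrices -/

/-- The sparse embedding (CountSketch) matrix `Φ Y` of a hash function `h` and signs `σ`: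
`Φ (h i) i = 1`, all other entries of `Φ` are `0`, and `Y = diag(σ)`. -/
def sparseEmbedding {n t : ℕ} (h : Fin n → Fin t) (σ : Fin n → ℝ) : Matrix (Fin t) (Fin n) ℝ :=
  (Matrix.of fun r i => if h i = r then (1 : ℝ) else 0) * Matrix.diagonal σ

/-- A `t × m` matrix scaled by `1 / √t`. -/
noncomputable def scaledMatrix {t m : ℕ} (g : Fin t → Fin m → ℝ) : Matrix (Fin t) (Fin m) ℝ :=
  (Real.sqrt t)⁻¹ • Matrix.of g

/-- `u i` are the diagonal entries of `D`, with distribution function `1 - exp (-G t)` on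
`t ≥ 0` (and `0` on `t < 0`); `σ i` are uniform signs, `h i` uniform hash values, `g a b`
standard Gaussians; all of these random variables are mutually independent. -/
structure IsSketchSample {Ω : Type*} [MeasurableSpace Ω] {n t₁ t₂ : ℕ} (G : ℝ → ℝ) (μ : Measure Ω)
    (u : Fin n → Ω → ℝ) (σ : Fin n → Ω → ℝ) (h : Fin n → Ω → Fin t₁)
    (g : Fin t₂ → Fin t₁ → Ω → ℝ) : Prop where
  measurable_u : ∀ i, Measurable (u i)
  measurable_σ : ∀ i, Measurable (σ i)
  measurable_h : ∀ i, Measurable (h i)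
  measurable_g : ∀ a b, Measurable (g a b)
  law_u : ∀ i t, μ.real {ω | u i ω ≤ t} = if 0 ≤ t then 1 - Real.exp (-G t) else 0
  law_σ : ∀ i, μ.real {ω | σ i ω = 1} = 1 / 2 ∧ μ.real {ω | σ i ω = -1} = 1 / 2
  law_h : ∀ i r, μ.real {ω | h i ω = r} = 1 / (t₁ : ℝ)
  law_g : ∀ a b, μ.map (g a b) = gaussianReal 0 1
  indep_u : iIndepFun u μ
  indep_σ : iIndepFun σ μ
  indep_h : iIndepFun h μ
  indep_g : iIndepFun (fun p : Fin t₂ × Fin t₁ => g p.1 p.2) μ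
  /-- The four families are independent of each other. -/
  indep_u_rest : IndepFun (fun ω i => u i ω)
    (fun ω => ((fun i => σ i ω), (fun i => h i ω), (fun a b => g a b ω))) μ
  indep_σ_rest : IndepFun (fun ω i => σ i ω)
    (fun ω => ((fun i => h i ω), (fun a b => g a b ω))) μ
  indep_h_g : IndepFun (fun ω i => h i ω) (fun ω a b => g a b ω) μ

/-! ### A real random access machine with a step count -/

namespace RealRAM

/-- Machine states: registers and arrays holding natural numbers (used as counters and
addresses), and registers and arrays holding real numbers. Arrays are named by numbers that are
fixed in the program; the positions in them are computed. -/
structure State where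
  nreg : ℕ → ℕ
  rreg : ℕ → ℝ
  nmem : ℕ → ℕ → ℕ
  rmem : ℕ → ℕ → ℝ

/-- Elementary instructions. There is no multiplication of natural numbers, no conversion
between numbers of different kind, and only rational constants. -/
inductive Instr where
  | nconst (r k : ℕ)
  | nadd (r a b : ℕ)
  | nsub (r a b : ℕ)
  | nload (r arr a : ℕ)
  | nstore (arr a r : ℕ)
  | rconst (r : ℕ) (q : ℚ)
  | radd (r a b : ℕ)
  | rsub (r a b : ℕ)
  | rmul (r a b : ℕ)
  | rdiv (r a b : ℕ)
  | rload (r arr a : ℕ)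
  | rstore (arr a r : ℕ)

/-- The effect of an instruction: `r` is the target register, `a` and `b` are source registers;
loads and stores access the cell of the array `arr` whose index is in the register `a`. -/
noncomputable def Instr.eval : Instr → State → State
  | .nconst r k, s => { s with nreg := Function.update s.nreg r k }
  | .nadd r a b, s => { s with nreg := Function.update s.nreg r (s.nreg a + s.nreg b) }
  | .nsub r a b, s => { s with nreg := Function.update s.nreg r (s.nreg a - s.nreg b) }
  | .nload r arr a, s => { s with nreg := Function.update s.nreg r (s.nmem arr (s.nreg a)) }
  | .nstore arr a r, s => { s with
      nmem := Function.update s.nmem arr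
        (Function.update (s.nmem arr) (s.nreg a) (s.nreg r)) }
  | .rconst r q, s => { s with rreg := Function.update s.rreg r (q : ℝ) }
  | .radd r a b, s => { s with rreg := Function.update s.rreg r (s.rreg a + s.rreg b) }
  | .rsub r a b, s => { s with rreg := Function.update s.rreg r (s.rreg a - s.rreg b) }
  | .rmul r a b, s => { s with rreg := Function.update s.rreg r (s.rreg a * s.rreg b) }
  | .rdiv r a b, s => { s with rreg := Function.update s.rreg r (s.rreg a / s.rreg b) }
  | .rload r arr a, s => { s with rreg := Function.update s.rreg r (s.rmem arr (s.nreg a)) }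
  | .rstore arr a r, s => { s with
      rmem := Function.update s.rmem arr
        (Function.update (s.rmem arr) (s.nreg a) (s.rreg r)) }

/-- Elementary tests: comparison of two registers of the same kind. -/
inductive Test where
  | nlt (a b : ℕ)
  | rlt (a b : ℕ)

def Test.Holds : Test → State → Prop
  | .nlt a b, s => s.nreg a < s.nreg b
  | .rlt a b, s => s.rreg a < s.rreg b

/-- Programs. -/
inductive Program where
  | instr (i : Instr)
  | seq (P Q : Program)
  | cond (c : Test) (P Q : Program)
  | loop (c : Test) (P : Program)

/-- `Exec P s s' T`: started in the state `s`, the program `P` halts in the state `s'` after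
exactly `T` steps. Every executed instruction and every evaluated test is one step. -/
inductive Exec : Program → State → State → ℕ → Prop where
  | instr (i : Instr) (s : State) : Exec (.instr i) s (i.eval s) 1
  | seq {P Q : Program} {s s' s'' : State} {T T' : ℕ} :
      Exec P s s' T → Exec Q s' s'' T' → Exec (.seq P Q) s s'' (T + T')
  | cond_true {c : Test} {P Q : Program} {s s' : State} {T : ℕ} :
      c.Holds s → Exec P s s' T → Exec (.cond c P Q) s s' (T + 1)
  | cond_false {c : Test} {P Q : Program} {s s' : State} {T : ℕ} :
      ¬ c.Holds s → Exec Q s s' T → Exec (.cond c P Q) s s' (T + 1)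
  | loop_true {c : Test} {P : Program} {s s' s'' : State} {T T' : ℕ} :
      c.Holds s → Exec P s s' T → Exec (.loop c P) s' s'' T' →
        Exec (.loop c P) s s'' (T + T' + 1)
  | loop_false {c : Test} {P : Program} {s : State} :
      ¬ c.Holds s → Exec (.loop c P) s s 1

end RealRAM

/-- The number of nonzero entries. -/
noncomputable def nnz {n d : ℕ} (A : Matrix (Fin n) (Fin d) ℝ) : ℕ :=
  Nat.card {p : Fin n × Fin d // A p.1 p.2 ≠ 0}

/-- A vector as the content of an array, padded by zeros. -/
def toArray {α : Type*} [Zero α] {n : ℕ} (v : Fin n → α) : ℕ → α :=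
  fun k => if hk : k < n then v ⟨k, hk⟩ else 0

/-- A matrix as the content of an array, row by row: the entry `(i, j)` of a `p × q` matrix is
at position `i * q + j`. -/
def toRowMajor {p q : ℕ} (M : Matrix (Fin p) (Fin q) ℝ) : ℕ → ℝ :=
  toArray fun k : Fin (p * q) => M (finProdFinEquiv.symm k).1 (finProdFinEquiv.symm k).2

/-- The input of the computation. Registers `0, …, 4` hold `n, d, t₁, t₂, nnz A`. The matrix `A`
is given by the list of its nonzero entries (rows, columns, values) in the order `e`, the diagonal
matrix by its diagonal `u`, the sparse embedding by `h` and `σ`, and the dense matrix `M` by all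
its entries. All other registers and cells are `0`. -/
noncomputable def sketchInput {n d t₁ t₂ : ℕ} (A : Matrix (Fin n) (Fin d) ℝ)
    (e : Fin (nnz A) ≃ {p : Fin n × Fin d // A p.1 p.2 ≠ 0})
    (u : Fin n → ℝ) (σ : Fin n → ℝ) (h : Fin n → Fin t₁) (M : Matrix (Fin t₂) (Fin t₁) ℝ) :
    RealRAM.State where
  nreg
    | 0 => n
    | 1 => d
    | 2 => t₁
    | 3 => t₂
    | 4 => nnz A
    | _ => 0
  rreg _ := 0
  nmem
    | 0 => toArray fun k => ((e k).1.1 : ℕ)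
    | 1 => toArray fun k => ((e k).1.2 : ℕ)
    | 2 => toArray fun i => (h i : ℕ)
    | _ => fun _ => 0
  rmem
    | 0 => toArray fun k => A (e k).1.1 (e k).1.2
    | 1 => toArray u
    | 2 => toArray σ
    | 3 => toRowMajor M
    | _ => fun _ => 0

/-! ### The Orlicz norm as the gauge of a convex body -/

section OrliczFunction

variable {G : ℝ → ℝ}

/-! The heart of the matter is that `‖D⁻¹y‖₂` is comparable to the Orlicz norm of `y` on the whole
column space of `A` (`PropertyP.exists_reweighting_bounds`). The two sketching matrices are then
oblivious `ℓ₂` subspace embeddings, independent of `D`, and cost only constant factors.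

Lower bound. The tail of each weight `uᵢ` is `exp (-G)`, so by independence all `|yᵢ| / uᵢ` lie
below `a / l` with probability at most `exp (-∑ G (l |yᵢ| / a))`. If the Orlicz norm of `y` exceeds
`a`, then `∑ G (|yᵢ| / a) > 1`, and convexity with `G 0 = 0` extracts the factor `l`, so this is at
most `exp (-l)`. The euclidean norm dominates the largest coordinate. A grid in the coefficients has
`exp (O(d log n))` points, so a union bound forces `l` of order `d log n`, which is the loss on this
side.

Upper bound. An Auerbach basis `U` of the column space has bounded coefficients, so it suffices to
bound `∑ ‖D⁻¹Uⱼ‖₂`. Since `|y| / u > s` has probability at most `G (|y| / s)`, each of the `O(log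
n)` dyadic scales `s ≤ T` contributes at most `4 (C + T) G |y|` to the expected squares, by the
growth condition for `s < 1` and by convexity for `s ≥ 1`. Values above `T`, of order `d`, are
excluded by a union bound. Markov's inequality finishes. The same bound controls the rounding error
when the lower bound passes from the grid to the whole subspace (`seminorm_bounds_of_grid`).

Embeddings. For CountSketch, the inner-product errors of an orthonormal basis have small second
moments, as signed collisions are orthogonal (`sparseEmbedding_subspace`). For the Gaussian matrix,
Chernoff bounds are combined with a net of the sphere (`scaledMatrix_subspace`). Each is proved for
a fixed subspace and transferred by conditioning on the earlier randomness.

Running time. One pass over the nonzero entries accumulates `Π₁D⁻¹A`, at constant cost each;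
tabulating row offsets and multiplying by the dense factor cost a polynomial in `d`, `t₁`, `t₂`. -/

theorem PropertyP.mul_le_map_mul (hG : PropertyP G) {t x : ℝ} (ht : 1 ≤ t) (hx : 0 ≤ x) :
    t * G x ≤ G (t * x) := by
  have h0 : 0 < t := by linarith
  have h1 : 1 / t ≤ 1 := by rw [div_le_one h0]; exact ht
  have := hG.convex.2 (show t * x ∈ Set.Ici 0 by simp; positivity)
    (show (0 : ℝ) ∈ Set.Ici 0 by simp) (show 0 ≤ 1 / t by positivity) (show 0 ≤ 1 - 1 / t by linarith)
    (by ring)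
  simp only [smul_eq_mul, mul_zero, add_zero, hG.map_zero] at this
  rw [show 1 / t * (t * x) = x by field_simp] at this
  calc t * G x ≤ t * (1 / t * G (t * x)) := by gcongr
    _ = G (t * x) := by field_simp

theorem PropertyP.map_le_self (hG : PropertyP G) {x : ℝ} (hx : 0 ≤ x) (hx1 : x ≤ 1) : G x ≤ x := by
  have := hG.convex.2 (show (1 : ℝ) ∈ Set.Ici 0 by simp)
    (show (0 : ℝ) ∈ Set.Ici 0 by simp) hx (show 0 ≤ 1 - x by linarith) (by ring)
  simpa [hG.map_zero, hG.map_one] using this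

/-- The affine tail has positive slope. This is what makes the Orlicz norm dominate every
coordinate, and hence definite. -/
theorem PropertyP.one_lt_map (hG : PropertyP G) {x : ℝ} (hx : 1 < x) : 1 < G x := by
  obtain ⟨s, hs, h⟩ := hG.linear
  rw [h x hx]; nlinarith

/-- The set `{y | ∑ i, G |y i| ≤ 1}`, whose gauge is the Orlicz norm. -/
def orliczBall (n : ℕ) (G : ℝ → ℝ) : Set (Fin n → ℝ) := {y | ∑ i, G |y i| ≤ 1}

variable {n : ℕ}

/-- Gauge theory then supplies homogeneity and the triangle inequality. -/
theorem orliczNorm_eq_gauge (G : ℝ → ℝ) (y : Fin n → ℝ) :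
    orliczNorm G y = gauge (orliczBall n G) y := by
  rw [gauge_def', orliczNorm]
  congr 1
  ext α
  simp only [Set.mem_ofPred_eq, orliczBall, Set.mem_Ioi, Pi.smul_apply, smul_eq_mul]
  refine and_congr_right fun hα => ?_
  simp [abs_mul, abs_inv, abs_of_pos hα, div_eq_inv_mul]

theorem PropertyP.map_abs_convex (hG : PropertyP G) {a b x y : ℝ} (ha : 0 ≤ a) (hb : 0 ≤ b)
    (hab : a + b = 1) : G |a * x + b * y| ≤ a * G |x| + b * G |y| := by
  have h1 : |a * x + b * y| ≤ a * |x| + b * |y| := by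
    calc _ ≤ |a * x| + |b * y| := abs_add_le _ _
      _ = _ := by rw [abs_mul, abs_mul, abs_of_nonneg ha, abs_of_nonneg hb]
  refine (hG.monotone (by simp) (by simp; positivity) h1).trans ?_
  simpa using hG.convex.2 (show |x| ∈ Set.Ici 0 by simp) (show |y| ∈ Set.Ici 0 by simp) ha hb hab

theorem PropertyP.convex_orliczBall (hG : PropertyP G) : Convex ℝ (orliczBall n G) := by
  intro x hx y hy a b ha hb hab
  simp only [orliczBall, Set.mem_ofPred_eq, Pi.add_apply, Pi.smul_apply, smul_eq_mul] at *
  calc ∑ i, G |a * x i + b * y i| ≤ ∑ i, (a * G |x i| + b * G |y i|) :=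
        Finset.sum_le_sum fun i _ => hG.map_abs_convex ha hb hab
    _ = a * ∑ i, G |x i| + b * ∑ i, G |y i| := by
        rw [Finset.sum_add_distrib, Finset.mul_sum, Finset.mul_sum]
    _ ≤ a * 1 + b * 1 := by gcongr
    _ = 1 := by linarith

theorem PropertyP.zero_mem_orliczBall (hG : PropertyP G) : (0 : Fin n → ℝ) ∈ orliczBall n G := by
  simp [orliczBall, hG.map_zero]

theorem PropertyP.balanced_orliczBall (hG : PropertyP G) : Balanced ℝ (orliczBall n G) := by
  rintro a ha _ ⟨y, hy, rfl⟩
  simp only [orliczBall, Set.mem_ofPred_eq, Pi.smul_apply, smul_eq_mul] at *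
  refine (Finset.sum_le_sum fun i _ => hG.monotone (Set.mem_Ici.2 (abs_nonneg _))
    (Set.mem_Ici.2 (abs_nonneg _)) ?_).trans hy
  rw [abs_mul]
  exact mul_le_of_le_one_left (abs_nonneg _) (by simpa using ha)

/-- Convexity puts `G` below the identity on `[0, 1]`, so the `ℓ₁` unit ball lies in the Orlicz
ball. Absorbency and continuity both rest on this. -/
theorem PropertyP.sum_le_one (hG : PropertyP G) {y : Fin n → ℝ} (hy : ∑ i, |y i| ≤ 1) :
    y ∈ orliczBall n G := by
  refine le_trans (Finset.sum_le_sum fun i _ => hG.map_le_self (abs_nonneg _) ?_) hy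
  exact (Finset.single_le_sum (f := fun i => |y i|) (fun i _ => abs_nonneg _)
    (Finset.mem_univ i)).trans hy

theorem PropertyP.absorbent_orliczBall (hG : PropertyP G) : Absorbent ℝ (orliczBall n G) := by
  rw [absorbent_iff_eventually_nhdsNE_zero]
  intro x
  have h : Tendsto (fun c : ℝ => ∑ i, |(c • x) i|) (𝓝[≠] 0) (𝓝 0) := by
    have : Continuous (fun c : ℝ => ∑ i, |(c • x) i|) := by
      simp only [Pi.smul_apply, smul_eq_mul]; fun_prop
    simpa using (this.tendsto 0).mono_left nhdsWithin_le_nhds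
  filter_upwards [h.eventually (eventually_le_nhds one_pos)] with c hc
  exact hG.sum_le_one hc

/-- The Orlicz norm as a seminorm. -/
noncomputable def PropertyP.orliczSeminorm (n : ℕ) (hG : PropertyP G) : Seminorm ℝ (Fin n → ℝ) :=
  gaugeSeminorm hG.balanced_orliczBall hG.convex_orliczBall hG.absorbent_orliczBall

theorem PropertyP.orliczNorm_eq (hG : PropertyP G) (y : Fin n → ℝ) :
    orliczNorm G y = hG.orliczSeminorm n y := orliczNorm_eq_gauge G y

/-- Strictness of the hypothesis spares a proof that the ball is closed. It is the reason why the
basis is later scaled to norm at most `1 / 2`. -/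
theorem PropertyP.sum_map_le_one (hG : PropertyP G) {y : Fin n → ℝ} (hy : orliczNorm G y < 1) :
    ∑ i, G |y i| ≤ 1 := by
  rw [orliczNorm_eq_gauge] at hy
  exact setOfPred_gauge_lt_one_subset_self hG.convex_orliczBall hG.zero_mem_orliczBall
    hG.absorbent_orliczBall hy

theorem one_lt_sum_of_lt_orliczNorm {y : Fin n → ℝ} {a : ℝ} (ha : 0 < a)
    (hy : a < orliczNorm G y) : 1 < ∑ i, G (|y i| / a) := by
  by_contra! h
  exact absurd (csInf_le ⟨0, fun b hb => le_of_lt hb.1⟩ (Set.mem_ofPred.2 ⟨ha, h⟩)) (not_le.2 hy)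

/-- Otherwise `y` would be `b • z` with `z` in the ball and `b < |y i|`; then `|z i| > 1`, and the
single term `G |z i|` already exceeds `1`. -/
theorem PropertyP.abs_le_orliczNorm (hG : PropertyP G) (y : Fin n → ℝ) (i : Fin n) :
    |y i| ≤ orliczNorm G y := by
  by_contra! h
  rw [orliczNorm_eq_gauge] at h
  obtain ⟨b, hb, hlt, z, hz, hzy⟩ := exists_lt_of_gauge_lt hG.absorbent_orliczBall h
  have h2 : 1 < |z i| := by
    have : y i = b * z i := by rw [← hzy]; simp
    rw [this, abs_mul, abs_of_pos hb] at hlt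
    by_contra! h3
    nlinarith
  have h3 := Finset.single_le_sum (f := fun i => G |z i|) (fun i _ => hG.nonneg _)
    (Finset.mem_univ i)
  have h4 : ∑ i, G |z i| ≤ 1 := hz
  have := hG.one_lt_map h2
  linarith

theorem PropertyP.orliczNorm_le_sum (hG : PropertyP G) (y : Fin n → ℝ) :
    orliczNorm G y ≤ ∑ i, |y i| := by
  rcases (Finset.sum_nonneg fun i (_ : i ∈ Finset.univ) => abs_nonneg (y i)).eq_or_lt with h | h
  · have : y = 0 := by
      ext i
      have := (Finset.sum_eq_zero_iff_of_nonneg fun i _ => abs_nonneg (y i)).1 h.symm i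
        (Finset.mem_univ i)
      simpa using this
    rw [this, hG.orliczNorm_eq]; simp
  · refine csInf_le ⟨0, fun b hb => le_of_lt hb.1⟩ (Set.mem_ofPred.2 ⟨h, ?_⟩)
    have key := hG.sum_le_one (y := fun i => y i / ∑ i, |y i|) (by
      simp only [abs_div, abs_of_pos h]
      rw [← Finset.sum_div, div_self h.ne'])
    simpa only [orliczBall, Set.mem_ofPred_eq, abs_div, abs_of_pos h] using key

theorem PropertyP.continuous_orliczNorm (hG : PropertyP G) :
    Continuous (fun y : Fin n → ℝ => orliczNorm G y) := by
  have : LipschitzWith n (hG.orliczSeminorm n) := by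
    refine LipschitzWith.of_le_add_mul _ fun x y => ?_
    have h1 : hG.orliczSeminorm n x ≤ hG.orliczSeminorm n y + hG.orliczSeminorm n (x - y) := by
      simpa using map_add_le_add (hG.orliczSeminorm n) y (x - y)
    have h2 := hG.orliczNorm_le_sum (x - y)
    rw [hG.orliczNorm_eq] at h2
    have h3 := Finset.sum_le_card_nsmul Finset.univ (fun i => |(x - y) i|) ‖x - y‖
      fun i _ => norm_le_pi_norm (x - y) i
    rw [dist_eq_norm]
    simp only [Finset.card_univ, Fintype.card_fin, nsmul_eq_mul] at h3
    push_cast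
    linarith
  simpa only [hG.orliczNorm_eq] using this.continuous

end OrliczFunction

/-- A finite-dimensional normed space has an Auerbach basis: unit vectors whose coordinate
functionals are bounded by the norm. -/
theorem exists_auerbach_basis {E : Type*} [NormedAddCommGroup E] [NormedSpace ℝ E]
    [FiniteDimensional ℝ E] (p : Seminorm ℝ E) (hp : Continuous p) {c : ℝ} (hc : 0 < c)
    (hpc : ∀ x, c * ‖x‖ ≤ p x) :
    ∃ b : Module.Basis (Fin (Module.finrank ℝ E)) ℝ E,
      (∀ i, p (b i) ≤ 1) ∧ ∀ x i, |b.repr x i| ≤ p x := by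
  set r := Module.finrank ℝ E
  let e := Module.finBasis ℝ E
  have hpos : ∀ x, x ≠ 0 → 0 < p x := fun x hx =>
    lt_of_lt_of_le (mul_pos hc (norm_pos_iff.2 hx)) (hpc x)
  -- Maximise `|det|` over tuples from the unit ball of `p`, which is compact because `p` dominates
  -- a multiple of the norm.
  let K : Set (Fin r → E) := {v | ∀ i, p (v i) ≤ 1}
  have hKc : IsCompact K := by
    refine Metric.isCompact_of_isClosed_isBounded ?_ ?_
    · have : K = ⋂ i, {v : Fin r → E | p (v i) ≤ 1} := by ext; simp [K]
      rw [this]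
      exact isClosed_iInter fun i => isClosed_le (hp.comp (continuous_apply i)) continuous_const
    · refine (Metric.isBounded_closedBall (x := (0 : Fin r → E)) (r := 1 / c)).subset fun v hv => ?_
      rw [mem_closedBall_zero_iff, pi_norm_le_iff_of_nonneg (by positivity)]
      intro i
      rw [le_div_iff₀ hc, mul_comm]
      exact (hpc _).trans (hv i)
  have hcont : Continuous fun v : Fin r → E => |e.det v| := by
    have : Continuous fun v : Fin r → E => e.det v := by
      simp only [Module.Basis.det_apply]
      refine Continuous.matrix_det ?_
      refine continuous_matrix fun i j => ?_
      simp only [Module.Basis.toMatrix_apply]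
      exact ((e.coord i).continuous_of_finiteDimensional).comp (continuous_apply j)
    exact this.abs
  -- A competitor with nonzero determinant, so that the maximiser is a basis.
  let v₀ : Fin r → E := fun i => (p (e i))⁻¹ • e i
  have hv₀ : v₀ ∈ K := fun i => by
    have := hpos _ (e.ne_zero i)
    simp [v₀, map_smul_eq_mul, abs_of_pos this, this.ne']
  obtain ⟨v, hvK, hvmax⟩ := hKc.exists_isMaxOn ⟨v₀, hv₀⟩ hcont.continuousOn
  have hdet0 : 0 < |e.det v₀| := by
    have : e.det v₀ = ∏ i, (p (e i))⁻¹ := by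
      have := e.det.map_smul_univ (fun i => (p (e i))⁻¹) e
      rw [e.det_self] at this
      simpa [v₀] using this
    rw [this, abs_pos, Finset.prod_ne_zero_iff]
    exact fun i _ => inv_ne_zero (hpos _ (e.ne_zero i)).ne'
  have hdet : 0 < |e.det v| := hdet0.trans_le (hvmax hv₀)
  obtain ⟨hli, hsp⟩ := (e.is_basis_iff_det (v := v)).2 (isUnit_iff_ne_zero.2 (abs_pos.1 hdet))
  have key : ∀ x i, p x ≤ 1 → |(Module.Basis.mk hli hsp.ge).repr x i| ≤ 1 := by
    intro x i hx
    -- Cramer's rule: a coordinate times `det v` is the determinant with one vector replaced by `x`,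
    -- which maximality bounds by `|det v|`.
    have h1 := DFunLike.congr_fun (e.det_smul_mk_coord_eq_det_update hli hsp.ge i) x
    simp only [LinearMap.smul_apply, Module.Basis.coord_apply, smul_eq_mul] at h1
    have h2 : Function.update v i x ∈ K := by
      intro j
      rcases eq_or_ne j i with rfl | hj
      · simpa using hx
      · simpa [hj] using hvK j
    have h3 : |e.det (Function.update v i x)| ≤ |e.det v| := hvmax h2
    have h4 : |e.det v| * |(Module.Basis.mk hli hsp.ge).repr x i| ≤ |e.det v| := by
      rw [← abs_mul, h1]; exact h3
    by_contra! h
    nlinarith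
  refine ⟨Module.Basis.mk hli hsp.ge, fun i => ?_, fun x i => ?_⟩
  · simpa using hvK i
  · rcases eq_or_ne x 0 with rfl | hx
    · simp only [map_zero, Finsupp.coe_zero, Pi.zero_apply, abs_zero, le_refl]
    · have h0 := hpos x hx
      have := key ((p x)⁻¹ • x) i (by simp [map_smul_eq_mul, abs_of_pos h0, h0.ne'])
      simp only [map_smul, Finsupp.smul_apply, smul_eq_mul, abs_mul, abs_inv, abs_of_pos h0] at this
      rwa [inv_mul_le_iff₀ h0, mul_one] at this

/-! ### Second moments of signed hash collisions -/

section SparseEmbedding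

variable {Ω : Type*} [MeasurableSpace Ω] {μ : Measure Ω} [IsProbabilityMeasure μ]

theorem ae_sign_eq {s : Ω → ℝ} (hs : Measurable s)
    (h : μ.real {ω | s ω = 1} = 1 / 2 ∧ μ.real {ω | s ω = -1} = 1 / 2) :
    ∀ᵐ ω ∂μ, s ω = 1 ∨ s ω = -1 := by
  have m1 : MeasurableSet {ω | s ω = 1} := hs (measurableSet_singleton 1)
  have m2 : MeasurableSet {ω | s ω = -1} := hs (measurableSet_singleton (-1))
  have hu : μ.real ({ω | s ω = 1} ∪ {ω | s ω = -1}) = 1 := by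
    rw [measureReal_union _ m2, h.1, h.2]
    · norm_num
    · rw [Set.disjoint_left]
      intro ω h1 h2
      simp only [Set.mem_ofPred_eq] at h1 h2
      linarith
  have hc : μ.real ({ω | s ω = 1} ∪ {ω | s ω = -1})ᶜ = 0 := by
    rw [probReal_compl_eq_one_sub (m1.union m2), hu, sub_self]
  rw [measureReal_eq_zero_iff] at hc
  rw [ae_iff]
  convert hc using 2
  ext ω
  simp [not_or]

theorem integral_sign_eq_zero {s : Ω → ℝ} (hs : Measurable s)
    (h : μ.real {ω | s ω = 1} = 1 / 2 ∧ μ.real {ω | s ω = -1} = 1 / 2) :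
    ∫ ω, s ω ∂μ = 0 := by
  have m1 : MeasurableSet {ω | s ω = 1} := hs (measurableSet_singleton 1)
  have m2 : MeasurableSet {ω | s ω = -1} := hs (measurableSet_singleton (-1))
  have : s =ᵐ[μ] fun ω => Set.indicator {ω | s ω = 1} 1 ω - Set.indicator {ω | s ω = -1} 1 ω := by
    filter_upwards [ae_sign_eq hs h] with ω hω
    rcases hω with hω | hω <;> simp [Set.indicator_apply, hω] <;> norm_num
  rw [integral_congr_ae this, integral_sub, integral_indicator_one m1, integral_indicator_one m2,
    h.1, h.2, sub_self]
  · exact (integrable_const (1 : ℝ)).indicator m1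
  · exact (integrable_const (1 : ℝ)).indicator m2

/-- The sign at `a` is independent of the other three and has mean zero. The indices `b`, `c`, `e`
may coincide. -/
theorem integral_four_signs_eq_zero {ι : Type*} {s : ι → Ω → ℝ} (hm : ∀ i, Measurable (s i))
    (hl : ∀ i, μ.real {ω | s i ω = 1} = 1 / 2 ∧ μ.real {ω | s i ω = -1} = 1 / 2)
    (hi : iIndepFun s μ) {a b c e : ι} (hab : a ≠ b) (hac : a ≠ c) (hae : a ≠ e) :
    ∫ ω, s a ω * (s b ω * s c ω * s e ω) ∂μ = 0 := by
  classical
  have h := hi.indepFun_finset {a} {b, c, e} (by simp [hab, hac, hae]) hm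
  have h2 : IndepFun (s a) (fun ω => s b ω * s c ω * s e ω) μ :=
    h.comp (φ := fun f : ({a} : Finset ι) → ℝ => f ⟨a, by simp⟩)
      (ψ := fun f : ({b, c, e} : Finset ι) → ℝ => f ⟨b, by simp⟩ * f ⟨c, by simp⟩ * f ⟨e, by simp⟩)
      (by fun_prop) (by fun_prop)
  rw [h2.integral_fun_mul_eq_mul_integral (hm a).aestronglyMeasurable
    (by fun_prop), integral_sign_eq_zero (hm a) (hl a), zero_mul]

variable {n t : ℕ}

/-- The indicator of a collision of the hash function, with sign. -/
noncomputable def signedCollision (σ : Fin n → Ω → ℝ) (h : Fin n → Ω → Fin t)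
    (p : Fin n × Fin n) (ω : Ω) : ℝ :=
  (if h p.1 ω = h p.2 ω then 1 else 0) * (σ p.1 ω * σ p.2 ω)

variable {σ : Fin n → Ω → ℝ} {h : Fin n → Ω → Fin t}

omit [MeasurableSpace Ω] in
theorem abs_signedCollision_le {ω : Ω} (hω : ∀ i, σ i ω = 1 ∨ σ i ω = -1) (p : Fin n × Fin n) :
    |signedCollision σ h p ω| ≤ 1 := by
  have : ∀ i, |σ i ω| = 1 := fun i => by rcases hω i with h | h <;> simp [h]
  simp only [signedCollision, abs_mul, this]
  split_ifs <;> simp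

theorem measurable_collision (hm : ∀ i, Measurable (h i)) (i j : Fin n) :
    Measurable fun ω => if h i ω = h j ω then (1 : ℝ) else 0 :=
  Measurable.ite (measurableSet_eq_fun (hm i) (hm j)) measurable_const measurable_const

theorem measurable_signedCollision (hσ : ∀ i, Measurable (σ i)) (hm : ∀ i, Measurable (h i))
    (p : Fin n × Fin n) : Measurable (signedCollision σ h p) :=
  (measurable_collision hm _ _).mul ((hσ _).mul (hσ _))

theorem ae_forall_sign_eq (hσ : ∀ i, Measurable (σ i))
    (hl : ∀ i, μ.real {ω | σ i ω = 1} = 1 / 2 ∧ μ.real {ω | σ i ω = -1} = 1 / 2) :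
    ∀ᵐ ω ∂μ, ∀ i, σ i ω = 1 ∨ σ i ω = -1 :=
  ae_all_iff.2 fun i => ae_sign_eq (hσ i) (hl i)

theorem integral_collision (hm : ∀ i, Measurable (h i))
    (hl : ∀ i r, μ.real {ω | h i ω = r} = 1 / (t : ℝ)) (hi : iIndepFun h μ) {i j : Fin n}
    (hij : i ≠ j) : ∫ ω, (if h i ω = h j ω then (1 : ℝ) else 0) ∂μ = 1 / t := by
  have h1 : ∀ ω, (if h i ω = h j ω then (1 : ℝ) else 0) =
      ∑ r, Set.indicator ({ω | h i ω = r} ∩ {ω | h j ω = r}) 1 ω := by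
    intro ω
    rw [Finset.sum_eq_single (h i ω)]
    · simp [Set.indicator_apply, eq_comm]
    · intro b _ hb
      simp [hb.symm]
    · simp
  have hM : ∀ i r, MeasurableSet {ω | h i ω = r} := fun i r => hm i (measurableSet_singleton r)
  simp_rw [h1]
  rw [integral_finsetSum]
  · have : ∀ r, ∫ ω, Set.indicator ({ω | h i ω = r} ∩ {ω | h j ω = r}) (1 : Ω → ℝ) ω ∂μ =
        1 / t * (1 / t) := by
      intro r
      rw [integral_indicator_one ((hM i r).inter (hM j r))]
      have := (hi.indepFun hij).measure_inter_preimage_eq_mul {r} {r} (measurableSet_singleton r)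
        (measurableSet_singleton r)
      rw [measureReal_def]
      have h2 : μ ({ω | h i ω = r} ∩ {ω | h j ω = r}) = μ {ω | h i ω = r} * μ {ω | h j ω = r} := this
      rw [h2, ENNReal.toReal_mul, ← measureReal_def, ← measureReal_def, hl, hl]
    simp_rw [this]
    simp only [Finset.sum_const, Finset.card_univ, Fintype.card_fin, nsmul_eq_mul]
    -- For `t = 0` both sides vanish because division by zero gives zero.
    rcases Nat.eq_zero_or_pos t with rfl | ht
    · simp
    · have : (t : ℝ) ≠ 0 := by positivity
      field_simp
  · exact fun r _ => (integrable_const (1 : ℝ)).indicator ((hM i r).inter (hM j r))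

/-- Two distinct increasing pairs always leave some index of `p` that does not occur in `q`. Its
sign makes the expectation of the four signs vanish, and the hash factor splits off by independence.
-/
theorem integral_signedCollision_mul (hσ : ∀ i, Measurable (σ i))
    (hl : ∀ i, μ.real {ω | σ i ω = 1} = 1 / 2 ∧ μ.real {ω | σ i ω = -1} = 1 / 2)
    (hσi : iIndepFun σ μ) (hm : ∀ i, Measurable (h i))
    (hσh : IndepFun (fun ω i => σ i ω) (fun ω i => h i ω) μ) {p q : Fin n × Fin n}
    (hp : p.1 < p.2) (hq : q.1 < q.2) (hpq : p ≠ q) :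
    ∫ ω, signedCollision σ h p ω * signedCollision σ h q ω ∂μ = 0 := by
  have h4 : ∫ ω, σ p.1 ω * σ p.2 ω * (σ q.1 ω * σ q.2 ω) ∂μ = 0 := by
    by_cases h1 : p.1 ≠ q.1 ∧ p.1 ≠ q.2
    · rw [← integral_four_signs_eq_zero hσ hl hσi hp.ne h1.1 h1.2]
      congr 1; ext ω; ring
    -- If `p.1` occurs in `q`, then `p.2` cannot: both pairs are increasing and they differ.
    · have h2 : p.2 ≠ q.1 ∧ p.2 ≠ q.2 := by
        obtain ⟨p1, p2⟩ := p
        obtain ⟨q1, q2⟩ := q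
        simp only [ne_eq, Prod.mk.injEq, not_and, not_not] at *
        constructor
        · rintro rfl
          have := h1 hp.ne
          omega
        · rintro rfl
          by_cases h3 : p1 = q1
          · exact hpq h3 rfl
          · have := h1 h3
            omega
      rw [← integral_four_signs_eq_zero hσ hl hσi hp.ne' h2.1 h2.2]
      congr 1; ext ω; ring
  let A : (Fin n → Fin t) → ℝ := fun f =>
    (if f p.1 = f p.2 then 1 else 0) * (if f q.1 = f q.2 then 1 else 0)
  let B : (Fin n → ℝ) → ℝ := fun f => f p.1 * f p.2 * (f q.1 * f q.2)
  have hA : Measurable A := Measurable.of_discrete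
  have hB : Measurable B := by fun_prop
  have hind : IndepFun (fun ω => B fun i => σ i ω) (fun ω => A fun i => h i ω) μ :=
    hσh.comp hB hA
  have hsplit : ∀ ω, signedCollision σ h p ω * signedCollision σ h q ω =
      (B fun i => σ i ω) * (A fun i => h i ω) := by
    intro ω; simp only [signedCollision, A, B]; ring
  simp_rw [hsplit]
  rw [hind.integral_fun_mul_eq_mul_integral]
  · simp only [B]; rw [h4, zero_mul]
  · exact (hB.comp (measurable_pi_lambda _ hσ)).aestronglyMeasurable
  · exact (hA.comp (measurable_pi_lambda _ hm)).aestronglyMeasurable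

theorem integral_signedCollision_sq (hσ : ∀ i, Measurable (σ i))
    (hlσ : ∀ i, μ.real {ω | σ i ω = 1} = 1 / 2 ∧ μ.real {ω | σ i ω = -1} = 1 / 2)
    (hm : ∀ i, Measurable (h i)) (hl : ∀ i r, μ.real {ω | h i ω = r} = 1 / (t : ℝ))
    (hi : iIndepFun h μ) {p : Fin n × Fin n} (hp : p.1 < p.2) :
    ∫ ω, signedCollision σ h p ω * signedCollision σ h p ω ∂μ = 1 / t := by
  rw [← integral_collision hm hl hi hp.ne]
  refine integral_congr_ae ?_
  filter_upwards [ae_forall_sign_eq hσ hlσ] with ω hω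
  have : ∀ i, σ i ω * σ i ω = 1 := fun i => by rcases hω i with h | h <;> simp [h]
  have h2 : (σ p.1 ω * σ p.2 ω) * (σ p.1 ω * σ p.2 ω) = 1 := by
    rw [mul_mul_mul_comm, this, this, one_mul]
  simp only [signedCollision]
  split_ifs
  · simpa using h2
  · simp

theorem integral_sum_signedCollision_sq (hσ : ∀ i, Measurable (σ i))
    (hlσ : ∀ i, μ.real {ω | σ i ω = 1} = 1 / 2 ∧ μ.real {ω | σ i ω = -1} = 1 / 2)
    (hσi : iIndepFun σ μ) (hm : ∀ i, Measurable (h i))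
    (hl : ∀ i r, μ.real {ω | h i ω = r} = 1 / (t : ℝ)) (hi : iIndepFun h μ)
    (hσh : IndepFun (fun ω i => σ i ω) (fun ω i => h i ω) μ) (P : Finset (Fin n × Fin n))
    (hP : ∀ p ∈ P, p.1 < p.2) (a : Fin n × Fin n → ℝ) :
    Integrable (fun ω => (∑ p ∈ P, a p * signedCollision σ h p ω) ^ 2) μ ∧
    ∫ ω, (∑ p ∈ P, a p * signedCollision σ h p ω) ^ 2 ∂μ = (∑ p ∈ P, a p ^ 2) / t := by
  have hint : ∀ p q, Integrable (fun ω => signedCollision σ h p ω * signedCollision σ h q ω) μ := by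
    intro p q
    refine Integrable.of_bound (((measurable_signedCollision hσ hm p).mul
      (measurable_signedCollision hσ hm q)).aestronglyMeasurable) 1 ?_
    filter_upwards [ae_forall_sign_eq hσ hlσ] with ω hω
    rw [Real.norm_eq_abs, abs_mul]
    exact mul_le_one₀ (abs_signedCollision_le hω p) (abs_nonneg _) (abs_signedCollision_le hω q)
  have hexp : ∀ ω, (∑ p ∈ P, a p * signedCollision σ h p ω) ^ 2 =
      ∑ p ∈ P, ∑ q ∈ P, a p * a q * (signedCollision σ h p ω * signedCollision σ h q ω) := by
    intro ω
    rw [sq, Finset.sum_mul_sum]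
    refine Finset.sum_congr rfl fun p _ => Finset.sum_congr rfl fun q _ => by ring
  simp_rw [hexp]
  refine ⟨integrable_finsetSum _ fun p _ => integrable_finsetSum _ fun q _ =>
    (hint p q).const_mul _, ?_⟩
  rw [integral_finsetSum _ fun p _ => integrable_finsetSum _ fun q _ => (hint p q).const_mul _,
    Finset.sum_div]
  refine Finset.sum_congr rfl fun p hp => ?_
  rw [integral_finsetSum _ fun q _ => (hint p q).const_mul _, Finset.sum_eq_single p]
  · rw [integral_const_mul, integral_signedCollision_sq hσ hlσ hm hl hi (hP p hp)]
    ring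
  · intro q hq hqp
    rw [integral_const_mul, integral_signedCollision_mul hσ hlσ hσi hm hσh (hP p hp) (hP q hq)
      hqp.symm, mul_zero]
  · exact fun h => absurd hp h

end SparseEmbedding

/-! ### CountSketch as a subspace embedding -/

section

theorem sparseEmbedding_mulVec {n t : ℕ} (h : Fin n → Fin t) (σ : Fin n → ℝ) (x : Fin n → ℝ)
    (r : Fin t) :
    (sparseEmbedding h σ).mulVec x r = ∑ i, (if h i = r then 1 else 0) * (σ i * x i) := by
  simp only [sparseEmbedding, Matrix.mulVec, dotProduct, Matrix.mul_diagonal, Matrix.of_apply,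
    mul_assoc]

theorem sum_sparseEmbedding_mulVec_mul {n t : ℕ} (h : Fin n → Fin t) (σ : Fin n → ℝ)
    (x y : Fin n → ℝ) :
    ∑ r, (sparseEmbedding h σ).mulVec x r * (sparseEmbedding h σ).mulVec y r =
      ∑ p : Fin n × Fin n, (if h p.1 = h p.2 then 1 else 0) * (σ p.1 * σ p.2) * (x p.1 * y p.2) := by
  simp_rw [sparseEmbedding_mulVec, Finset.sum_mul_sum]
  rw [Finset.sum_comm, Fintype.sum_prod_type]
  refine Finset.sum_congr rfl fun i _ => ?_
  rw [Finset.sum_comm]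
  refine Finset.sum_congr rfl fun j _ => ?_
  rw [Finset.sum_eq_single (h i)]
  · simp only [if_true, eq_comm (a := h j)]
    ring
  · intro r _ hr
    simp [hr.symm]
  · simp

theorem sum_prod_eq_diag_add {n : ℕ} (f : Fin n × Fin n → ℝ) :
    ∑ p, f p = ∑ i, f (i, i) +
      ∑ p ∈ Finset.univ.filter (fun p : Fin n × Fin n => p.1 < p.2), (f p + f p.swap) := by
  have h1 : ∀ p : Fin n × Fin n, f p = (if p.1 = p.2 then f p else 0) +
      ((if p.1 < p.2 then f p else 0) + (if p.2 < p.1 then f p else 0)) := by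
    rintro ⟨i, j⟩
    rcases lt_trichotomy i j with h | h | h
    · simp [h, h.ne, h.not_gt]
    · simp [h]
    · simp [h, h.ne', h.not_gt]
  rw [Finset.sum_congr rfl fun p _ => h1 p, Finset.sum_add_distrib, Finset.sum_add_distrib,
    Finset.sum_add_distrib, Finset.sum_filter, Finset.sum_filter]
  congr 1
  · rw [Fintype.sum_prod_type]
    simp
  · congr 1
    rw [← (Equiv.prodComm (Fin n) (Fin n)).sum_comp]
    rfl

variable {Ω : Type*} [MeasurableSpace Ω] {μ : Measure Ω} [IsProbabilityMeasure μ]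
  {n t : ℕ} {σ : Fin n → Ω → ℝ} {h : Fin n → Ω → Fin t}

omit [MeasurableSpace Ω] in
-- Squared signs are `1`, so the diagonal reproduces the inner product exactly and the error
-- consists of collisions only.
theorem sum_sparseEmbedding_sub {ω : Ω} (hω : ∀ i, σ i ω = 1 ∨ σ i ω = -1) (x y : Fin n → ℝ) :
    ∑ r, (sparseEmbedding (fun i => h i ω) (fun i => σ i ω)).mulVec x r *
        (sparseEmbedding (fun i => h i ω) (fun i => σ i ω)).mulVec y r - ∑ i, x i * y i =
      ∑ p ∈ Finset.univ.filter (fun p : Fin n × Fin n => p.1 < p.2),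
        (x p.1 * y p.2 + x p.2 * y p.1) * signedCollision σ h p ω := by
  have hs : ∀ i, σ i ω * σ i ω = 1 := fun i => by rcases hω i with h | h <;> simp [h]
  rw [sum_sparseEmbedding_mulVec_mul, sum_prod_eq_diag_add]
  simp only [hs, if_true, one_mul, Prod.fst_swap, Prod.snd_swap, add_sub_cancel_left]
  refine Finset.sum_congr rfl fun p _ => ?_
  simp only [signedCollision, eq_comm (a := h p.2 ω)]
  ring

theorem integral_sparseEmbedding_sub_sq_le (hσ : ∀ i, Measurable (σ i))
    (hlσ : ∀ i, μ.real {ω | σ i ω = 1} = 1 / 2 ∧ μ.real {ω | σ i ω = -1} = 1 / 2)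
    (hσi : iIndepFun σ μ) (hm : ∀ i, Measurable (h i))
    (hl : ∀ i r, μ.real {ω | h i ω = r} = 1 / (t : ℝ)) (hi : iIndepFun h μ)
    (hσh : IndepFun (fun ω i => σ i ω) (fun ω i => h i ω) μ) (x y : Fin n → ℝ) :
    Integrable (fun ω => (∑ r, (sparseEmbedding (fun i => h i ω) (fun i => σ i ω)).mulVec x r *
        (sparseEmbedding (fun i => h i ω) (fun i => σ i ω)).mulVec y r - ∑ i, x i * y i) ^ 2) μ ∧
    ∫ ω, (∑ r, (sparseEmbedding (fun i => h i ω) (fun i => σ i ω)).mulVec x r *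
        (sparseEmbedding (fun i => h i ω) (fun i => σ i ω)).mulVec y r - ∑ i, x i * y i) ^ 2 ∂μ ≤
      2 * (∑ i, x i ^ 2) * (∑ i, y i ^ 2) / t := by
  have hae : (fun ω => (∑ r, (sparseEmbedding (fun i => h i ω) (fun i => σ i ω)).mulVec x r *
        (sparseEmbedding (fun i => h i ω) (fun i => σ i ω)).mulVec y r - ∑ i, x i * y i) ^ 2)
      =ᵐ[μ] fun ω => (∑ p ∈ Finset.univ.filter (fun p : Fin n × Fin n => p.1 < p.2),
        (x p.1 * y p.2 + x p.2 * y p.1) * signedCollision σ h p ω) ^ 2 := by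
    filter_upwards [ae_forall_sign_eq hσ hlσ] with ω hω
    rw [sum_sparseEmbedding_sub hω]
  have key := integral_sum_signedCollision_sq hσ hlσ hσi hm hl hi hσh
    (Finset.univ.filter (fun p : Fin n × Fin n => p.1 < p.2)) (by simp)
    (fun p => x p.1 * y p.2 + x p.2 * y p.1)
  refine ⟨key.1.congr hae.symm, ?_⟩
  rw [integral_congr_ae hae, key.2]
  gcongr
  -- Off the diagonal, `(a + b) ^ 2 ≤ 2 a ^ 2 + 2 b ^ 2`. The missing diagonal terms are nonnegative
  -- and complete the sum to a product.
  have h1 : 2 * (∑ i, x i ^ 2) * (∑ i, y i ^ 2) =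
      ∑ p : Fin n × Fin n, 2 * (x p.1 ^ 2 * y p.2 ^ 2) := by
    rw [mul_assoc, Finset.sum_mul_sum, Fintype.sum_prod_type, Finset.mul_sum]
    simp only [Finset.mul_sum]
  rw [h1, sum_prod_eq_diag_add]
  refine le_add_of_nonneg_of_le (by positivity) (Finset.sum_le_sum fun p _ => ?_)
  simp only [Prod.fst_swap, Prod.snd_swap]
  nlinarith [sq_nonneg (x p.1 * y p.2 - x p.2 * y p.1)]

/-- If `S` almost preserves the inner products of an orthonormal family, then it almost preserves
the norms of all linear combinations. -/
theorem abs_norm_sq_mulVec_sub_le {m k r : ℕ} (S : Matrix (Fin m) (Fin k) ℝ)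
    (q : Fin r → Fin k → ℝ) (hq : ∀ a b, ∑ i, q a i * q b i = if a = b then 1 else 0)
    {δ : ℝ} (hδ : 0 ≤ δ)
    (hS : ∑ a, ∑ b, (∑ i, S.mulVec (q a) i * S.mulVec (q b) i - ∑ i, q a i * q b i) ^ 2 ≤ δ ^ 2)
    (c : Fin r → ℝ) :
    |∑ i, S.mulVec (∑ a, c a • q a) i ^ 2 - ∑ i, (∑ a, c a • q a) i ^ 2| ≤
      δ * ∑ i, (∑ a, c a • q a) i ^ 2 := by
  have expand : ∀ {l : ℕ} (w : Fin r → Fin l → ℝ), ∑ i, (∑ a, c a • w a) i ^ 2 =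
      ∑ a, ∑ b, c a * c b * ∑ i, w a i * w b i := by
    intro l w
    simp only [Finset.sum_apply, Pi.smul_apply, smul_eq_mul, sq, Finset.sum_mul_sum]
    rw [Finset.sum_comm]
    refine Finset.sum_congr rfl fun a _ => ?_
    rw [Finset.sum_comm]
    refine Finset.sum_congr rfl fun b _ => ?_
    rw [Finset.mul_sum]
    exact Finset.sum_congr rfl fun i _ => by ring
  have h1 : S.mulVec (∑ a, c a • q a) = ∑ a, c a • S.mulVec (q a) := by
    rw [Matrix.mulVec_sum]
    exact Finset.sum_congr rfl fun a _ => Matrix.mulVec_smul _ _ _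
  have h2 : ∑ i, (∑ a, c a • q a) i ^ 2 = ∑ a, c a ^ 2 := by
    rw [expand]
    refine Finset.sum_congr rfl fun a _ => ?_
    simp [hq, sq]
  rw [h1, expand (fun a => S.mulVec (q a)), h2, ← h2, expand q, ← Finset.sum_sub_distrib]
  simp only [← Finset.sum_sub_distrib, ← mul_sub]
  rw [← expand q, h2]
  refine abs_le_of_sq_le_sq ?_ (by positivity)
  -- Cauchy–Schwarz over pairs: the Frobenius norm of the Gram error bounds its quadratic form.
  have hcs := Finset.sum_mul_sq_le_sq_mul_sq (Finset.univ : Finset (Fin r × Fin r))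
    (fun p => c p.1 * c p.2)
    (fun p => ∑ i, S.mulVec (q p.1) i * S.mulVec (q p.2) i - ∑ i, q p.1 i * q p.2 i)
  simp only [Fintype.sum_prod_type] at hcs
  refine hcs.trans ?_
  have h3 : ∑ a, ∑ b, (c a * c b) ^ 2 = (∑ a, c a ^ 2) ^ 2 := by
    rw [sq (∑ a, c a ^ 2), Finset.sum_mul_sum]
    simp only [mul_pow]
  rw [h3, mul_pow, mul_comm]
  gcongr

theorem norm_toLp_sq {n : ℕ} (x : Fin n → ℝ) : ‖WithLp.toLp 2 x‖ ^ 2 = ∑ i, x i ^ 2 := by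
  simp [EuclideanSpace.norm_sq_eq]

/-- Every column space has an orthonormal basis. -/
theorem exists_orthonormal_range {n d : ℕ} (Z : Matrix (Fin n) (Fin d) ℝ) :
    ∃ r ≤ d, ∃ q : Fin r → Fin n → ℝ, (∀ a b, ∑ i, q a i * q b i = if a = b then 1 else 0) ∧
      ∀ x, ∃ c : Fin r → ℝ, Z.mulVec x = ∑ a, c a • q a := by
  let V := LinearMap.range (Matrix.toLpLin 2 2 Z)
  let b := stdOrthonormalBasis ℝ V
  refine ⟨Module.finrank ℝ V, ?_, fun a => WithLp.ofLp (b a : EuclideanSpace ℝ (Fin n)), ?_, ?_⟩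
  · simpa using LinearMap.finrank_range_le (Matrix.toLpLin 2 2 Z)
  · intro a a'
    have := orthonormal_iff_ite.1 b.orthonormal a' a
    rw [Submodule.coe_inner, PiLp.inner_apply] at this
    simp only [RCLike.inner_apply, conj_trivial] at this
    rw [this]
    simp [eq_comm]
  · intro x
    let z : V := ⟨Matrix.toLpLin 2 2 Z (WithLp.toLp 2 x), LinearMap.mem_range_self _ _⟩
    refine ⟨fun a => b.repr z a, ?_⟩
    have := congrArg (fun v : V => WithLp.ofLp (v : EuclideanSpace ℝ (Fin n))) (b.sum_repr z)
    simp only [Submodule.coe_sum, Submodule.coe_smul, WithLp.ofLp_sum, WithLp.ofLp_smul] at this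
    rw [this]
    simp [z]

/-- For a fixed `d`-dimensional subspace, the sparse embedding into dimension `400 d ^ 2`
preserves all norms up to the factor `2`, except with probability `1 / 100`. -/
theorem sparseEmbedding_subspace (hσ : ∀ i, Measurable (σ i))
    (hlσ : ∀ i, μ.real {ω | σ i ω = 1} = 1 / 2 ∧ μ.real {ω | σ i ω = -1} = 1 / 2)
    (hσi : iIndepFun σ μ) (hm : ∀ i, Measurable (h i))
    (hl : ∀ i r, μ.real {ω | h i ω = r} = 1 / (t : ℝ)) (hi : iIndepFun h μ)
    (hσh : IndepFun (fun ω i => σ i ω) (fun ω i => h i ω) μ) {d : ℕ} (hd : 1 ≤ d)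
    (ht : 400 * (d : ℝ) ^ 2 ≤ t) (Z : Matrix (Fin n) (Fin d) ℝ) :
    μ.real {ω | ∃ x, 2 * ‖WithLp.toLp 2 (Z.mulVec x)‖ < ‖WithLp.toLp 2
        ((sparseEmbedding (fun i => h i ω) (fun i => σ i ω)).mulVec (Z.mulVec x))‖ ∨
      ‖WithLp.toLp 2 ((sparseEmbedding (fun i => h i ω) (fun i => σ i ω)).mulVec (Z.mulVec x))‖ <
        1 / 2 * ‖WithLp.toLp 2 (Z.mulVec x)‖} ≤ 1 / 100 := by
  obtain ⟨r, hr, q, hq, hZ⟩ := exists_orthonormal_range Z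
  let F : Ω → ℝ := fun ω => ∑ a, ∑ b,
    (∑ i, (sparseEmbedding (fun i => h i ω) (fun i => σ i ω)).mulVec (q a) i *
      (sparseEmbedding (fun i => h i ω) (fun i => σ i ω)).mulVec (q b) i - ∑ i, q a i * q b i) ^ 2
  have hI := fun a b => integral_sparseEmbedding_sub_sq_le hσ hlσ hσi hm hl hi hσh (q a) (q b)
  have hFint : Integrable F μ :=
    integrable_finsetSum _ fun a _ => integrable_finsetSum _ fun b _ => (hI a b).1
  have hd' : (1 : ℝ) ≤ d := by exact_mod_cast hd
  have ht0 : (0 : ℝ) < t := by nlinarith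
  -- At most `d ^ 2` pairs of unit vectors, each with second moment at most `2 / t`, where `t ≥ 400
  -- d ^ 2`.
  have hF : ∫ ω, F ω ∂μ ≤ 1 / 200 := by
    simp only [F]
    rw [integral_finsetSum _ fun a _ => integrable_finsetSum _ fun b _ => (hI a b).1]
    calc _ ≤ ∑ a : Fin r, ∑ b : Fin r, 2 / (t : ℝ) := by
          refine Finset.sum_le_sum fun a _ => ?_
          rw [integral_finsetSum _ fun b _ => (hI a b).1]
          refine Finset.sum_le_sum fun b _ => (hI a b).2.trans ?_
          have : ∀ a, ∑ i, q a i ^ 2 = 1 := fun a => by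
            simpa [sq] using hq a a
          rw [this, this]; simp
      _ = (r : ℝ) ^ 2 * (2 / t) := by simp; ring
      _ ≤ (d : ℝ) ^ 2 * (2 / t) := by gcongr
      _ ≤ 1 / 200 := by
          rw [← mul_div_assoc, div_le_div_iff₀ ht0 (by norm_num)]
          linarith
  have hF0 : ∀ ω, 0 ≤ F ω := fun ω =>
    Finset.sum_nonneg fun a _ => Finset.sum_nonneg fun b _ => sq_nonneg _
  -- The threshold is `(3 / 4) ^ 2`: a relative error `3 / 4` in the squared norm keeps the norm
  -- within a factor `2`. Markov gives `(1 / 200) / (9 / 16) < 1 / 100`.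
  have hmark := mul_meas_ge_le_integral_of_nonneg (Eventually.of_forall hF0) hFint (9 / 16)
  have hsub : {ω | ∃ x, 2 * ‖WithLp.toLp 2 (Z.mulVec x)‖ < ‖WithLp.toLp 2
        ((sparseEmbedding (fun i => h i ω) (fun i => σ i ω)).mulVec (Z.mulVec x))‖ ∨
      ‖WithLp.toLp 2 ((sparseEmbedding (fun i => h i ω) (fun i => σ i ω)).mulVec (Z.mulVec x))‖ <
        1 / 2 * ‖WithLp.toLp 2 (Z.mulVec x)‖} ⊆ {ω | 9 / 16 ≤ F ω} := by
    rintro ω ⟨x, hx⟩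
    by_contra hlt
    simp only [Set.mem_ofPred_eq, not_le] at hlt
    obtain ⟨c, hc⟩ := hZ x
    have := abs_norm_sq_mulVec_sub_le (sparseEmbedding (fun i => h i ω) (fun i => σ i ω)) q hq
      (δ := 3 / 4) (by norm_num) (hlt.le.trans (by norm_num)) c
    rw [← hc, ← norm_toLp_sq, ← norm_toLp_sq, abs_le] at this
    have h0 := norm_nonneg (WithLp.toLp 2 (Z.mulVec x))
    have h1 := norm_nonneg (WithLp.toLp 2
      ((sparseEmbedding (fun i => h i ω) (fun i => σ i ω)).mulVec (Z.mulVec x)))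
    rcases hx with hx | hx <;> nlinarith
  refine (measureReal_mono hsub).trans ?_
  linarith

end

/-! ### Chernoff bounds for Gaussian matrices -/

section GaussianEmbedding

theorem gaussianPDFReal_zero_one_mul_exp (s x : ℝ) :
    gaussianPDFReal 0 1 x * Real.exp (s * x ^ 2) =
      (Real.sqrt (2 * Real.pi))⁻¹ * Real.exp (-(1 / 2 - s) * x ^ 2) := by
  rw [gaussianPDFReal]
  simp only [NNReal.coe_one, mul_one, sub_zero]
  rw [mul_assoc, ← Real.exp_add]
  congr 2
  ring

theorem integral_exp_mul_sq_gaussianReal {s : ℝ} (hs : s < 1 / 2) :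
    ∫ x, Real.exp (s * x ^ 2) ∂(gaussianReal 0 1) = Real.sqrt (1 / (1 - 2 * s)) := by
  rw [integral_gaussianReal_eq_integral_smul one_ne_zero]
  simp only [smul_eq_mul, gaussianPDFReal_zero_one_mul_exp]
  rw [integral_const_mul, integral_gaussian, ← Real.sqrt_inv, ← Real.sqrt_mul (by positivity)]
  congr 1
  have : 1 / 2 - s ≠ 0 := by linarith
  have h2 : 1 - 2 * s ≠ 0 := by linarith
  field_simp

theorem integrable_exp_mul_sq_gaussianReal {s : ℝ} (hs : s < 1 / 2) :
    Integrable (fun x => Real.exp (s * x ^ 2)) (gaussianReal 0 1) := by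
  -- A nonintegrable function has integral `0` by convention, while this integral is positive.
  refine not_imp_comm.1 integral_undef ?_
  rw [integral_exp_mul_sq_gaussianReal hs]
  have : 0 < 1 - 2 * s := by linarith
  positivity

variable {Ω : Type*} [MeasurableSpace Ω] {μ : Measure Ω} [IsProbabilityMeasure μ]

omit [IsProbabilityMeasure μ] in
theorem mgf_sq_of_map_eq_gaussianReal {Z : Ω → ℝ} (hZ : Measurable Z)
    (h : μ.map Z = gaussianReal 0 1) {s : ℝ} (hs : s < 1 / 2) :
    Integrable (fun ω => Real.exp (s * Z ω ^ 2)) μ ∧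
      mgf (fun ω => Z ω ^ 2) μ s = Real.sqrt (1 / (1 - 2 * s)) := by
  have hm : AEStronglyMeasurable (fun x : ℝ => Real.exp (s * x ^ 2)) (μ.map Z) := by
    fun_prop
  constructor
  · have := integrable_exp_mul_sq_gaussianReal hs
    rw [← h] at this
    exact (integrable_map_measure hm hZ.aemeasurable).1 this
  · rw [mgf, ← integral_exp_mul_sq_gaussianReal hs, ← h, integral_map hZ.aemeasurable hm]

variable {m t : ℕ} {g : Fin t → Fin m → Ω → ℝ}

omit [IsProbabilityMeasure μ] in
theorem covariance_standard_gaussians (hm : ∀ a b, Measurable (g a b))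
    (hl : ∀ a b, μ.map (g a b) = gaussianReal 0 1)
    (hi : iIndepFun (fun p : Fin t × Fin m => g p.1 p.2) μ) (p q : Fin t × Fin m) :
    cov[g p.1 p.2, g q.1 q.2; μ] = if p = q then 1 else 0 := by
  have h2 : ∀ p : Fin t × Fin m, HasGaussianLaw (g p.1 p.2) μ := fun p =>
    ⟨by rw [hl]; infer_instance⟩
  split_ifs with hpq
  · subst hpq
    rw [covariance_self (hm _ _).aemeasurable, ← variance_id_map (hm _ _).aemeasurable, hl]
    simp
  · exact (hi.indepFun hpq).covariance_eq_zero (h2 p).memLp_two (h2 q).memLp_two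

omit [IsProbabilityMeasure μ] in
theorem hasGaussianLaw_rows (hl : ∀ a b, μ.map (g a b) = gaussianReal 0 1)
    (hi : iIndepFun (fun p : Fin t × Fin m => g p.1 p.2) μ) (v : Fin m → ℝ) :
    HasGaussianLaw (fun ω a => ∑ b, v b * g a b ω) μ := by
  have h2 : ∀ p : Fin t × Fin m, HasGaussianLaw (g p.1 p.2) μ := fun p =>
    ⟨by rw [hl]; infer_instance⟩
  have h3 := iIndepFun.hasGaussianLaw h2 hi
  let L : (Fin t × Fin m → ℝ) →L[ℝ] (Fin t → ℝ) :=
    ContinuousLinearMap.pi fun a => ∑ b, v b • ContinuousLinearMap.proj (a, b)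
  have hL : (fun ω a => ∑ b, v b * g a b ω) = fun ω => L fun p => g p.1 p.2 ω := by
    ext ω a
    simp [L]
  rw [hL]
  exact h3.map_fun L

theorem covariance_rows (hm : ∀ a b, Measurable (g a b))
    (hl : ∀ a b, μ.map (g a b) = gaussianReal 0 1)
    (hi : iIndepFun (fun p : Fin t × Fin m => g p.1 p.2) μ) (v : Fin m → ℝ) (a a' : Fin t) :
    cov[fun ω => ∑ b, v b * g a b ω, fun ω => ∑ b, v b * g a' b ω; μ] =
      if a = a' then ∑ b, v b ^ 2 else 0 := by
  have h2 : ∀ a b, MemLp (fun ω => v b * g a b ω) 2 μ := fun a b => by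
    have : HasGaussianLaw (g a b) μ := ⟨by rw [hl]; infer_instance⟩
    exact this.memLp_two.const_mul _
  rw [covariance_fun_sum_fun_sum (fun b => h2 a b) (fun b => h2 a' b)]
  simp only [covariance_const_mul_left, covariance_const_mul_right]
  have h3 := fun b b' => covariance_standard_gaussians hm hl hi (a, b) (a', b')
  simp only [Prod.mk.injEq] at h3
  simp only [h3]
  split_ifs with h
  · simp [h, sq]
  · simp [h]

/-- The rows applied to `v` are jointly Gaussian, as a linear image of independent Gaussians, so
being uncorrelated suffices. -/
theorem iIndepFun_rows (hm : ∀ a b, Measurable (g a b))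
    (hl : ∀ a b, μ.map (g a b) = gaussianReal 0 1)
    (hi : iIndepFun (fun p : Fin t × Fin m => g p.1 p.2) μ) (v : Fin m → ℝ) :
    iIndepFun (fun a ω => ∑ b, v b * g a b ω) μ := by
  refine (hasGaussianLaw_rows hl hi v).iIndepFun_of_covariance_eq_zero fun a a' h => ?_
  rw [covariance_rows hm hl hi, if_neg h]

theorem map_row_eq_gaussianReal (hm : ∀ a b, Measurable (g a b))
    (hl : ∀ a b, μ.map (g a b) = gaussianReal 0 1)
    (hi : iIndepFun (fun p : Fin t × Fin m => g p.1 p.2) μ) {v : Fin m → ℝ}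
    (hv : ∑ b, v b ^ 2 = 1) (a : Fin t) :
    μ.map (fun ω => ∑ b, v b * g a b ω) = gaussianReal 0 1 := by
  have h1 := (hasGaussianLaw_rows hl hi v).eval a
  have hmeas : Measurable (fun ω => ∑ b, v b * g a b ω) := by fun_prop
  have h2 : ∀ b, HasGaussianLaw (g a b) μ := fun b => ⟨by rw [hl]; infer_instance⟩
  have h3 : ∀ b, ∫ ω, g a b ω ∂μ = 0 := fun b => by
    have := integral_map (μ := μ) (hm a b).aemeasurable (f := id) (by fun_prop)
    rw [hl, show (∫ y, id y ∂(gaussianReal 0 1)) = 0 from integral_id_gaussianReal] at this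
    exact this.symm
  rw [h1.map_eq_gaussianReal, ← covariance_self hmeas.aemeasurable, covariance_rows hm hl hi,
    if_pos rfl, hv, integral_finsetSum _ fun b _ => (h2 b).integrable.const_mul _]
  simp [integral_const_mul, h3]

theorem mgf_sum_rows_sq (hm : ∀ a b, Measurable (g a b))
    (hl : ∀ a b, μ.map (g a b) = gaussianReal 0 1)
    (hi : iIndepFun (fun p : Fin t × Fin m => g p.1 p.2) μ) {v : Fin m → ℝ}
    (hv : ∑ b, v b ^ 2 = 1) {s : ℝ} (hs : s < 1 / 2) :
    Integrable (fun ω => Real.exp (s * ∑ a, (∑ b, v b * g a b ω) ^ 2)) μ ∧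
      mgf (fun ω => ∑ a, (∑ b, v b * g a b ω) ^ 2) μ s = Real.sqrt (1 / (1 - 2 * s)) ^ t := by
  have hind : iIndepFun (fun a ω => (∑ b, v b * g a b ω) ^ 2) μ :=
    (iIndepFun_rows hm hl hi v).comp (fun _ x => x ^ 2) fun _ => by fun_prop
  have hmeas : ∀ a, Measurable fun ω => (∑ b, v b * g a b ω) ^ 2 := fun a => by fun_prop
  have hZ := fun a => mgf_sq_of_map_eq_gaussianReal (by fun_prop)
    (map_row_eq_gaussianReal hm hl hi hv a) hs
  constructor
  · have := hind.integrable_exp_mul_sum hmeas (s := Finset.univ) (t := s) fun a _ => (hZ a).1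
    simpa only [Finset.sum_apply] using this
  · have := hind.mgf_sum (t := s) hmeas Finset.univ
    simp only [(hZ _).2, Finset.prod_const, Finset.card_univ, Fintype.card_fin] at this
    rw [← this]
    congr 1
    ext ω
    simp

theorem measure_sum_rows_sq_ge_le (hm : ∀ a b, Measurable (g a b))
    (hl : ∀ a b, μ.map (g a b) = gaussianReal 0 1)
    (hi : iIndepFun (fun p : Fin t × Fin m => g p.1 p.2) μ) {v : Fin m → ℝ}
    (hv : ∑ b, v b ^ 2 = 1) :
    μ.real {ω | 4 * (t : ℝ) ≤ ∑ a, (∑ b, v b * g a b ω) ^ 2} ≤ Real.exp (-(t / 4 : ℝ)) := by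
  have h := mgf_sum_rows_sq hm hl hi hv (s := 1 / 4) (by norm_num)
  refine (measure_ge_le_exp_mul_mgf _ (by norm_num) h.1).trans ?_
  rw [h.2]
  -- At `s = 1 / 4` each moment generating factor is `√2 ≤ exp (3 / 4)`, and `-t + 3 t / 4 = -t /
  -- 4`.
  have h1 : Real.sqrt (1 / (1 - 2 * (1 / 4))) ≤ Real.exp (3 / 4) := by
    rw [Real.sqrt_le_left (Real.exp_pos _).le]
    have := Real.add_one_le_exp (3 / 4 : ℝ)
    nlinarith
  calc _ ≤ Real.exp (-(1 / 4) * (4 * t)) * Real.exp (3 / 4) ^ t := by gcongr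
    _ = _ := by rw [← Real.exp_nat_mul, ← Real.exp_add]; congr 1; ring

theorem measure_sum_rows_sq_le_le (hm : ∀ a b, Measurable (g a b))
    (hl : ∀ a b, μ.map (g a b) = gaussianReal 0 1)
    (hi : iIndepFun (fun p : Fin t × Fin m => g p.1 p.2) μ) {v : Fin m → ℝ}
    (hv : ∑ b, v b ^ 2 = 1) :
    μ.real {ω | ∑ a, (∑ b, v b * g a b ω) ^ 2 ≤ (t / 4 : ℝ)} ≤ Real.exp (-(t / 4 : ℝ)) := by
  have h := mgf_sum_rows_sq hm hl hi hv (s := -1) (by norm_num)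
  refine (measure_le_le_exp_mul_mgf _ (by norm_num) h.1).trans ?_
  rw [h.2]
  -- At `s = -1` each factor is `1 / √3 ≤ exp (-1 / 2)`, since `e < 3`, and `t / 4 - t / 2 = -t /
  -- 4`.
  have h1 : Real.sqrt (1 / (1 - 2 * (-1))) ≤ Real.exp (-(1 / 2)) := by
    rw [Real.sqrt_le_left (Real.exp_pos _).le, sq, ← Real.exp_add]
    norm_num
    rw [Real.exp_neg, one_div, inv_le_inv₀ (by norm_num) (Real.exp_pos _)]
    linarith [Real.exp_one_lt_d9]
  calc _ ≤ Real.exp (-(-1) * (t / 4)) * Real.exp (-(1 / 2)) ^ t := by gcongr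
    _ = _ := by rw [← Real.exp_nat_mul, ← Real.exp_add]; congr 1; ring

/-- Norms of single vectors are preserved by a Gaussian matrix. -/
theorem measure_scaledMatrix_norm_fail_le (ht : 0 < t) (hm : ∀ a b, Measurable (g a b))
    (hl : ∀ a b, μ.map (g a b) = gaussianReal 0 1)
    (hi : iIndepFun (fun p : Fin t × Fin m => g p.1 p.2) μ) (w : Fin m → ℝ) :
    μ.real {ω | 2 * ‖WithLp.toLp 2 w‖ <
        ‖WithLp.toLp 2 ((scaledMatrix fun a b => g a b ω).mulVec w)‖ ∨
      ‖WithLp.toLp 2 ((scaledMatrix fun a b => g a b ω).mulVec w)‖ < 1 / 2 * ‖WithLp.toLp 2 w‖} ≤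
    2 * Real.exp (-(t / 4 : ℝ)) := by
  have ht' : (0 : ℝ) < t := by exact_mod_cast ht
  set N := ‖WithLp.toLp 2 w‖ with hN
  rcases (norm_nonneg (WithLp.toLp 2 w)).eq_or_lt with h0 | h0
  · have hw : w = 0 := by
      have := norm_eq_zero.1 h0.symm
      simpa using this
    subst hw
    simp only [Matrix.mulVec_zero]
    simp [N]
    positivity
  · rw [← hN] at h0
    let v : Fin m → ℝ := fun b => N⁻¹ * w b
    have hv : ∑ b, v b ^ 2 = 1 := by
      simp only [v, mul_pow, ← Finset.mul_sum]
      rw [← norm_toLp_sq, ← hN]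
      field_simp
    have hS : ∀ ω, ‖WithLp.toLp 2 ((scaledMatrix fun a b => g a b ω).mulVec w)‖ ^ 2 =
        N ^ 2 / t * ∑ a, (∑ b, v b * g a b ω) ^ 2 := by
      intro ω
      rw [norm_toLp_sq, Finset.mul_sum]
      refine Finset.sum_congr rfl fun a _ => ?_
      have h1 : (scaledMatrix fun a b => g a b ω).mulVec w a =
          (Real.sqrt t)⁻¹ * (N * ∑ b, v b * g a b ω) := by
        simp only [scaledMatrix, Matrix.mulVec, dotProduct, Matrix.smul_apply, Matrix.of_apply,
          smul_eq_mul, Finset.mul_sum, v]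
        exact Finset.sum_congr rfl fun b _ => by field_simp
      rw [h1, mul_pow, mul_pow, inv_pow, Real.sq_sqrt ht'.le]
      ring
    refine (measureReal_mono (s₂ := {ω | 4 * (t : ℝ) ≤ ∑ a, (∑ b, v b * g a b ω) ^ 2} ∪
      {ω | ∑ a, (∑ b, v b * g a b ω) ^ 2 ≤ (t / 4 : ℝ)}) ?_).trans
      ((measureReal_union_le _ _).trans ?_)
    · intro ω hω
      have h2 := hS ω
      have h3 := norm_nonneg (WithLp.toLp 2 ((scaledMatrix fun a b => g a b ω).mulVec w))
      have h4 : ∑ a, (∑ b, v b * g a b ω) ^ 2 = t / N ^ 2 *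
          ‖WithLp.toLp 2 ((scaledMatrix fun a b => g a b ω).mulVec w)‖ ^ 2 := by
        rw [h2]; field_simp
      rcases hω with h | h
      · left
        simp only [Set.mem_ofPred_eq, h4]
        rw [div_mul_eq_mul_div, le_div_iff₀ (by positivity), mul_comm 4, mul_assoc]
        exact mul_le_mul_of_nonneg_left (by nlinarith) ht'.le
      · right
        simp only [Set.mem_ofPred_eq, h4]
        rw [div_mul_eq_mul_div, div_le_iff₀ (by positivity), div_mul_eq_mul_div, mul_div_assoc]
        exact mul_le_mul_of_nonneg_left (by nlinarith) ht'.le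
    · linarith [measure_sum_rows_sq_ge_le hm hl hi hv, measure_sum_rows_sq_le_le hm hl hi hv]

end GaussianEmbedding

/-! ### A net of the sphere and the Gaussian subspace embedding -/

section

section LatticeNet

theorem sum_Icc_half_pow_natAbs (L : ℕ) :
    ∑ k ∈ Finset.Icc (-(L : ℤ)) L, (1 / 2 : ℝ) ^ k.natAbs = 3 - 2 * (1 / 2) ^ L := by
  induction L with
  | zero => norm_num
  | succ L ih =>
    have h : Finset.Icc (-((L + 1 : ℕ) : ℤ)) ((L + 1 : ℕ) : ℤ) =
        insert ((L + 1 : ℕ) : ℤ) (insert (-((L + 1 : ℕ) : ℤ)) (Finset.Icc (-(L : ℤ)) L)) := by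
      ext k; simp only [Finset.mem_Icc, Finset.mem_insert]; omega
    rw [h, Finset.sum_insert, Finset.sum_insert, ih, Int.natAbs_neg, Int.natAbs_natCast, pow_succ]
    · ring
    · simp only [Finset.mem_Icc]; omega
    · simp only [Finset.mem_insert, Finset.mem_Icc]; omega

/-- The integer points in a multiple of the cross-polytope. -/
noncomputable def latticeNet (r : ℕ) : Finset (Fin r → ℤ) :=
  (Fintype.piFinset fun _ => Finset.Icc (-((11 * r : ℕ) : ℤ)) ((11 * r : ℕ) : ℤ)).filter
    fun z => ∑ a, (z a).natAbs ≤ 11 * r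

theorem mem_latticeNet {r : ℕ} {z : Fin r → ℤ} :
    z ∈ latticeNet r ↔ ∑ a, (z a).natAbs ≤ 11 * r := by
  simp only [latticeNet, Finset.mem_filter, Fintype.mem_piFinset, Finset.mem_Icc,
    and_iff_right_iff_imp]
  intro h a
  have := (Finset.single_le_sum (f := fun a => (z a).natAbs) (fun _ _ => Nat.zero_le _)
    (Finset.mem_univ a)).trans h
  omega

/-- A generating function count: every point of the net satisfies `1 ≤ 2 ^ (11 r) ∏ 2 ^ (-|zₐ|)`,
and the sum of the right side over a box factors into geometric sums, each at most `3`. -/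
theorem card_latticeNet_le (r : ℕ) : ((latticeNet r).card : ℝ) ≤ Real.exp (13 * r) := by
  have h1 : ((latticeNet r).card : ℝ) ≤ 2 ^ (11 * r) * 3 ^ r := by
    calc ((latticeNet r).card : ℝ) = ∑ z ∈ latticeNet r, (1 : ℝ) := by simp
      _ ≤ ∑ z ∈ latticeNet r, 2 ^ (11 * r) * ∏ a, (1 / 2 : ℝ) ^ (z a).natAbs := by
          refine Finset.sum_le_sum fun z hz => ?_
          rw [Finset.prod_pow_eq_pow_sum, one_div, inv_pow, ← div_eq_mul_inv,
            one_le_div (by positivity)]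
          exact pow_le_pow_right₀ (by norm_num) (mem_latticeNet.1 hz)
      _ ≤ ∑ z ∈ Fintype.piFinset fun _ : Fin r =>
            Finset.Icc (-((11 * r : ℕ) : ℤ)) ((11 * r : ℕ) : ℤ),
            2 ^ (11 * r) * ∏ a, (1 / 2 : ℝ) ^ (z a).natAbs :=
          Finset.sum_le_sum_of_subset_of_nonneg (Finset.filter_subset _ _)
            fun _ _ _ => by positivity
      _ = 2 ^ (11 * r) * ∏ _a : Fin r,
            ∑ k ∈ Finset.Icc (-((11 * r : ℕ) : ℤ)) ((11 * r : ℕ) : ℤ), (1 / 2 : ℝ) ^ k.natAbs := by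
          rw [← Finset.mul_sum, Finset.prod_univ_sum]
      _ ≤ 2 ^ (11 * r) * 3 ^ r := by
          rw [Finset.prod_const, Finset.card_univ, Fintype.card_fin, sum_Icc_half_pow_natAbs]
          gcongr
          · have : (1 / 2 : ℝ) ^ (11 * r) ≤ 1 := pow_le_one₀ (by norm_num) (by norm_num)
            linarith
          · linarith [show (0 : ℝ) ≤ 2 * (1 / 2) ^ (11 * r) by positivity]
  refine h1.trans ?_
  have h2 : (2 : ℝ) ≤ Real.exp 1 := by linarith [Real.add_one_le_exp (1 : ℝ)]
  calc (2 : ℝ) ^ (11 * r) * 3 ^ r = (2 ^ 11 * 3) ^ r := by rw [mul_pow, pow_mul]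
    _ ≤ (2 ^ 13) ^ r := by gcongr; norm_num
    _ ≤ (Real.exp 1 ^ 13) ^ r := by gcongr
    _ = Real.exp (13 * r) := by
        rw [← pow_mul, ← Real.exp_nat_mul]; push_cast; ring_nf

/-- The point of the net of the unit sphere that belongs to an integer point. -/
noncomputable def netPoint {r : ℕ} (z : Fin r → ℤ) : EuclideanSpace ℝ (Fin r) :=
  WithLp.toLp 2 fun a => (z a : ℝ) / (10 * Real.sqrt r)

/-- Round each coordinate of `10 √r c`. The error per coordinate of `c` is at most `1 / (20 √r)`, so
`1 / 20` in `ℓ₂`. Since `‖c‖₁ ≤ √r`, the rounded vector has `ℓ₁` norm at most `10 r + r / 2`, whence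
the radius `11 r`. Net points need not be unit vectors. -/
theorem exists_netPoint_near {r : ℕ} {c : EuclideanSpace ℝ (Fin r)} (hc : ‖c‖ = 1) :
    ∃ z ∈ latticeNet r, ‖c - netPoint z‖ ≤ 1 / 20 := by
  have hr : 0 < r := by
    rcases Nat.eq_zero_or_pos r with rfl | h
    · rw [Subsingleton.elim c 0, norm_zero] at hc; norm_num at hc
    · exact h
  have hr' : (0 : ℝ) < r := by exact_mod_cast hr
  set s := Real.sqrt r with hs
  have hs0 : 0 < s := Real.sqrt_pos.2 hr'
  have hss : s ^ 2 = r := Real.sq_sqrt hr'.le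
  have hc2 : ∑ a, c a ^ 2 = 1 := by
    have := EuclideanSpace.norm_sq_eq c
    rw [hc] at this
    simpa using this.symm
  let z : Fin r → ℤ := fun a => round (10 * s * c a)
  have hz : ∀ a, |10 * s * c a - z a| ≤ 1 / 2 := fun a => abs_sub_round _
  refine ⟨z, mem_latticeNet.2 ?_, ?_⟩
  · have h1 : ∀ a, ((z a).natAbs : ℝ) ≤ 10 * s * |c a| + 1 / 2 := by
      intro a
      rw [Nat.cast_natAbs, Int.cast_abs]
      have h2 := abs_sub_abs_le_abs_sub (z a : ℝ) (10 * s * c a)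
      rw [abs_sub_comm] at h2
      rw [abs_mul, abs_of_pos (show 0 < 10 * s by positivity)] at h2
      linarith [hz a]
    have h3 : (∑ a, |c a|) ≤ s := by
      refine abs_le_of_sq_le_sq' ?_ hs0.le |>.2
      have := sq_sum_le_card_mul_sum_sq (s := Finset.univ) (f := fun a => |c a|)
      simp only [sq_abs, hc2, Finset.card_univ, Fintype.card_fin, mul_one] at this
      rw [hss]; exact this
    have h4 : (∑ a, ((z a).natAbs : ℝ)) ≤ 11 * r := by
      calc (∑ a, ((z a).natAbs : ℝ)) ≤ ∑ a, (10 * s * |c a| + 1 / 2) :=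
            Finset.sum_le_sum fun a _ => h1 a
        _ = 10 * s * ∑ a, |c a| + r * (1 / 2) := by
            rw [Finset.sum_add_distrib, ← Finset.mul_sum]; simp
        _ ≤ 10 * s * s + r * (1 / 2) := by gcongr
        _ ≤ 11 * r := by nlinarith
    exact_mod_cast h4
  · refine abs_le_of_sq_le_sq' ?_ (by norm_num) |>.2
    rw [EuclideanSpace.norm_sq_eq]
    calc ∑ a, ‖(c - netPoint z) a‖ ^ 2 ≤ ∑ _a : Fin r, (1 / (20 * s)) ^ 2 := by
          refine Finset.sum_le_sum fun a _ => ?_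
          have : (c - netPoint z) a = (10 * s * c a - z a) / (10 * s) := by
            simp only [netPoint, PiLp.sub_apply, ← hs]
            field_simp
          rw [this, Real.norm_eq_abs, abs_div, abs_of_pos (show 0 < 10 * s by positivity)]
          refine pow_le_pow_left₀ (by positivity) ?_ 2
          rw [show 1 / (20 * s) = 1 / 2 / (10 * s) by field_simp; norm_num]
          gcongr
          exact hz a
      _ = (1 / 20) ^ 2 := by
          simp only [Finset.sum_const, Finset.card_univ, Fintype.card_fin, nsmul_eq_mul]
          rw [← hss]; field_simp

/-- A linear map that almost preserves the norms on the net almost preserves all norms. -/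
theorem norm_bounds_of_netPoint {r : ℕ} {F : Type*} [NormedAddCommGroup F] [NormedSpace ℝ F]
    (L : EuclideanSpace ℝ (Fin r) →L[ℝ] F)
    (h : ∀ z ∈ latticeNet r, 1 / 2 * ‖netPoint z‖ ≤ ‖L (netPoint z)‖ ∧
      ‖L (netPoint z)‖ ≤ 2 * ‖netPoint z‖) (c : EuclideanSpace ℝ (Fin r)) :
    1 / 3 * ‖c‖ ≤ ‖L c‖ ∧ ‖L c‖ ≤ 3 * ‖c‖ := by
  -- Here `2.1 = 2 (1 + 1 / 20)` and `0.475 = (1 - 1 / 20) / 2`, as net points have norm within `1 /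
  -- 20` of `1`.
  have near : ∀ c : EuclideanSpace ℝ (Fin r), ‖c‖ = 1 →
      ‖L c‖ ≤ 2.1 + ‖L‖ / 20 ∧ 0.475 - ‖L‖ / 20 ≤ ‖L c‖ := by
    intro c hc
    obtain ⟨z, hz, hcz⟩ := exists_netPoint_near hc
    obtain ⟨h1, h2⟩ := h z hz
    have h3 : ‖L (c - netPoint z)‖ ≤ ‖L‖ * (1 / 20) := L.le_of_opNorm_le_of_le le_rfl hcz
    rw [map_sub] at h3
    have h4 := abs_le.1 (abs_norm_sub_norm_le (L c) (L (netPoint z)))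
    have h5 := abs_le.1 (abs_norm_sub_norm_le c (netPoint z))
    rw [hc] at h5
    constructor <;> linarith
  have hom : ∀ c : EuclideanSpace ℝ (Fin r), c ≠ 0 → ‖L c‖ = ‖c‖ * ‖L (‖c‖⁻¹ • c)‖ := by
    intro c hc
    have := norm_pos_iff.2 hc
    rw [map_smul, norm_smul, norm_inv, norm_norm]
    field_simp
  have unit : ∀ c : EuclideanSpace ℝ (Fin r), c ≠ 0 → ‖‖c‖⁻¹ • c‖ = 1 := by
    intro c hc
    have := norm_pos_iff.2 hc
    rw [norm_smul, norm_inv, norm_norm, inv_mul_cancel₀ this.ne']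
  -- The operator norm bounds itself: this gives `‖L‖ ≤ 42 / 19`, so the error `‖L‖ / 20` is small
  -- enough for the final constants.
  have hL : ‖L‖ ≤ 2.1 + ‖L‖ / 20 := by
    refine L.opNorm_le_bound (by positivity) fun c => ?_
    rcases eq_or_ne c 0 with rfl | hc
    · simp
    · rw [hom c hc, mul_comm]
      gcongr
      exact (near _ (unit c hc)).1
  rcases eq_or_ne c 0 with rfl | hc
  · simp
  · rw [hom c hc]
    have h1 := near _ (unit c hc)
    have h2 := norm_pos_iff.2 hc
    constructor <;> rw [mul_comm] <;> nlinarith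

end LatticeNet

variable {Ω : Type*} [MeasurableSpace Ω] {μ : Measure Ω} [IsProbabilityMeasure μ]
  {m t : ℕ} {g : Fin t → Fin m → Ω → ℝ}

/-- For a fixed `d`-dimensional subspace, a Gaussian matrix with `80 d` rows preserves all norms
up to the factor `3`, except with probability `1 / 100`. -/
theorem scaledMatrix_subspace (hm : ∀ a b, Measurable (g a b))
    (hl : ∀ a b, μ.map (g a b) = gaussianReal 0 1)
    (hi : iIndepFun (fun p : Fin t × Fin m => g p.1 p.2) μ) {d : ℕ} (hd : 1 ≤ d)
    (ht : 80 * (d : ℝ) ≤ t) (W : Matrix (Fin m) (Fin d) ℝ) :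
    μ.real {ω | ∃ x, 3 * ‖WithLp.toLp 2 (W.mulVec x)‖ <
        ‖WithLp.toLp 2 ((scaledMatrix fun a b => g a b ω).mulVec (W.mulVec x))‖ ∨
      ‖WithLp.toLp 2 ((scaledMatrix fun a b => g a b ω).mulVec (W.mulVec x))‖ <
        1 / 3 * ‖WithLp.toLp 2 (W.mulVec x)‖} ≤ 1 / 100 := by
  obtain ⟨r, hr, q, hq, hW⟩ := exists_orthonormal_range W
  have hd' : (1 : ℝ) ≤ d := by exact_mod_cast hd
  have ht0 : 0 < t := by
    have : (0 : ℝ) < t := by linarith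
    exact_mod_cast this
  let Q : EuclideanSpace ℝ (Fin r) →ₗ[ℝ] (Fin m → ℝ) :=
    (Fintype.linearCombination ℝ q).comp (WithLp.linearEquiv 2 ℝ (Fin r → ℝ)).toLinearMap
  have hQ : ∀ c, Q c = ∑ a, c a • q a := fun c => by
    simp [Q, Fintype.linearCombination_apply]
  have hQn : ∀ c, ‖WithLp.toLp 2 (Q c)‖ = ‖c‖ := by
    intro c
    rw [← sq_eq_sq₀ (norm_nonneg _) (norm_nonneg _), norm_toLp_sq, EuclideanSpace.norm_sq_eq, hQ]
    simp only [Finset.sum_apply, Pi.smul_apply, smul_eq_mul, sq, Finset.sum_mul_sum,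
      Real.norm_eq_abs, abs_mul_abs_self]
    rw [Finset.sum_comm]
    refine Finset.sum_congr rfl fun a _ => ?_
    rw [Finset.sum_comm]
    have : ∀ b, ∑ i, c a * q a i * (c b * q b i) = c a * c b * if a = b then 1 else 0 := by
      intro b
      rw [← hq a b, Finset.mul_sum]
      exact Finset.sum_congr rfl fun i _ => by ring
    simp [this]
  let bad : (Fin r → ℤ) → Set Ω := fun z => {ω | 2 * ‖WithLp.toLp 2 (Q (netPoint z))‖ <
        ‖WithLp.toLp 2 ((scaledMatrix fun a b => g a b ω).mulVec (Q (netPoint z)))‖ ∨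
      ‖WithLp.toLp 2 ((scaledMatrix fun a b => g a b ω).mulVec (Q (netPoint z)))‖ <
        1 / 2 * ‖WithLp.toLp 2 (Q (netPoint z))‖}
  refine (measureReal_mono (s₂ := ⋃ z ∈ latticeNet r, bad z) ?_ (measure_ne_top _ _)).trans
    ((measureReal_biUnion_finset_le _ _).trans ?_)
  · rintro ω ⟨x, hx⟩
    by_contra hgood
    simp only [bad, Set.mem_iUnion, exists_prop, not_exists, not_and, Set.mem_ofPred_eq, not_or,
      not_lt, hQn] at hgood
    let L : EuclideanSpace ℝ (Fin r) →L[ℝ] EuclideanSpace ℝ (Fin t) :=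
      LinearMap.toContinuousLinearMap ((WithLp.linearEquiv 2 ℝ (Fin t → ℝ)).symm.toLinearMap.comp
        ((scaledMatrix fun a b => g a b ω).mulVecLin.comp Q))
    have hL : ∀ c, L c = WithLp.toLp 2 ((scaledMatrix fun a b => g a b ω).mulVec (Q c)) :=
      fun c => rfl
    obtain ⟨c, hc⟩ := hW x
    have := norm_bounds_of_netPoint L (fun z hz => by
      rw [hL]; exact ⟨(hgood z hz).2, (hgood z hz).1⟩) (WithLp.toLp 2 c)
    rw [hL, ← hQn, hQ, ← hc] at this
    rcases hx with hx | hx <;> linarith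
  · calc ∑ z ∈ latticeNet r, μ.real (bad z) ≤ ∑ z ∈ latticeNet r, 2 * Real.exp (-(t / 4 : ℝ)) :=
          Finset.sum_le_sum fun z _ => measure_scaledMatrix_norm_fail_le ht0 hm hl hi _
      _ = (latticeNet r).card * (2 * Real.exp (-(t / 4 : ℝ))) := by simp
      _ ≤ Real.exp (13 * r) * (2 * Real.exp (-(t / 4 : ℝ))) := by
          gcongr; exact card_latticeNet_le r
      _ = 2 * Real.exp (13 * r - t / 4) := by rw [sub_eq_add_neg, Real.exp_add]; ring
      -- With `r ≤ d` and `t ≥ 80 d`, the exponent is at most `13 d - 20 d ≤ -7`.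
      _ ≤ 2 * Real.exp (-7) := by
          gcongr
          have : (r : ℝ) ≤ d := by exact_mod_cast hr
          linarith
      _ ≤ 1 / 100 := by
          have h1 : (200 : ℝ) ≤ Real.exp 7 := by
            have : (2.7 : ℝ) ^ 7 ≤ Real.exp 1 ^ 7 := by
              gcongr; linarith [Real.exp_one_gt_d9]
            rw [← Real.exp_nat_mul] at this
            norm_num at this ⊢
            linarith
          rw [Real.exp_neg, ← div_eq_mul_inv, div_le_div_iff₀ (Real.exp_pos _) (by norm_num)]
          linarith

end

/-! ### Tails and small balls for the reciprocal weights -/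

section ReciprocalWeights

variable {G : ℝ → ℝ} {Ω : Type*} [MeasurableSpace Ω] {μ : Measure Ω} [IsProbabilityMeasure μ]
  {n : ℕ} {u : Fin n → Ω → ℝ}

omit [IsProbabilityMeasure μ] in
theorem ae_weights_pos [IsFiniteMeasure μ] (hG : PropertyP G)
    (hl : ∀ i t, μ.real {ω | u i ω ≤ t} = if 0 ≤ t then 1 - Real.exp (-G t) else 0) :
    ∀ᵐ ω ∂μ, ∀ i, 0 < u i ω := by
  refine ae_all_iff.2 fun i => ?_
  have h := hl i 0
  simp only [le_refl, if_true, hG.map_zero, neg_zero, Real.exp_zero, sub_self] at h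
  rw [measureReal_eq_zero_iff] at h
  rw [ae_iff]
  simpa only [not_lt] using h

/-- The event forces `u i ≤ |y| / s`, and `1 - exp (-G) ≤ G`. -/
theorem measure_lt_mul_inv_le
    (hl : ∀ i t, μ.real {ω | u i ω ≤ t} = if 0 ≤ t then 1 - Real.exp (-G t) else 0) (i : Fin n)
    (y : ℝ) {s : ℝ} (hs : 0 < s) : μ.real {ω | s < |y| * (u i ω)⁻¹} ≤ G (|y| / s) := by
  have hsub : {ω | s < |y| * (u i ω)⁻¹} ⊆ {ω | u i ω ≤ |y| / s} := by
    intro ω hω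
    simp only [Set.mem_ofPred_eq] at hω ⊢
    rcases le_or_gt (u i ω) 0 with h | h
    · exact h.trans (by positivity)
    · rw [← div_eq_mul_inv, lt_div_iff₀ h] at hω
      rw [le_div_iff₀ hs]
      linarith
  refine (measureReal_mono hsub).trans ?_
  rw [hl, if_pos (by positivity)]
  linarith [Real.add_one_le_exp (-G (|y| / s))]

theorem PropertyP.map_div_le (hG : PropertyP G) {x s : ℝ} (hx : 0 ≤ x) (hs : 1 ≤ s) :
    s * G (x / s) ≤ G x := by
  have := hG.mul_le_map_mul hs (x := x / s) (by positivity)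
  rwa [mul_div_cancel₀ x (by linarith)] at this

/-- Two regimes. For `s ≥ 1`, convexity controls only `s G (x / s)`, and the second factor `s` costs
`T`. For `s < 1`, the quadratic growth condition absorbs `s ^ 2` at cost `C`. -/
theorem PropertyP.sq_mul_map_div_le (hG : PropertyP G) {C : ℝ} (hC : 0 < C)
    (hgrow : ∀ x y, 0 < x → x < y → 0 < G x ∧ G y / G x ≤ C * (y / x) ^ 2) {x s T : ℝ}
    (hx : 0 ≤ x) (hs : 0 < s) (hsT : s ≤ T) : s ^ 2 * G (x / s) ≤ (C + T) * G x := by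
  have hT : 0 < T := hs.trans_le hsT
  have h0 := hG.nonneg x
  rcases le_or_gt 1 s with h1 | h1
  · calc s ^ 2 * G (x / s) = s * (s * G (x / s)) := by ring
      _ ≤ T * G x := by
        gcongr
        · exact mul_nonneg hs.le (hG.nonneg _)
        · exact hG.map_div_le hx h1
      _ ≤ (C + T) * G x := by nlinarith
  · rcases hx.eq_or_lt with rfl | hx
    · simp [hG.map_zero]
    · have hlt : x < x / s := by rw [lt_div_iff₀ hs]; nlinarith
      obtain ⟨hpos, hle⟩ := hgrow x (x / s) hx hlt
      rw [div_le_iff₀ hpos, show x / s / x = s⁻¹ by field_simp] at hle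
      calc s ^ 2 * G (x / s) ≤ s ^ 2 * (C * s⁻¹ ^ 2 * G x) := by gcongr
        _ = C * G x := by field_simp
        _ ≤ (C + T) * G x := by nlinarith

/-- The largest scale strictly below `w` alone contributes `(2 τ 2 ^ k) ^ 2 ≥ w ^ 2`; below `τ` the
first summand suffices. The cap on `w` is needed because reciprocal weights may have infinite second
moment. -/
theorem sq_le_dyadic_sum {τ w : ℝ} (hw : 0 ≤ w) (K : ℕ) (hwT : w ≤ τ * 2 ^ K) :
    w ^ 2 ≤ τ ^ 2 + ∑ k ∈ Finset.range K, 4 * (τ * 2 ^ k) ^ 2 * (if τ * 2 ^ k < w then 1 else 0) := by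
  induction K with
  | zero =>
    simp only [pow_zero, mul_one, Finset.range_zero, Finset.sum_empty, add_zero] at hwT ⊢
    gcongr
  | succ K ih =>
    rw [Finset.sum_range_succ]
    by_cases h : τ * 2 ^ K < w
    · rw [if_pos h]
      have h1 : 0 ≤ ∑ k ∈ Finset.range K,
          4 * (τ * 2 ^ k) ^ 2 * (if τ * 2 ^ k < w then (1 : ℝ) else 0) :=
        Finset.sum_nonneg fun k _ => by split_ifs <;> positivity
      have h2 : w ^ 2 ≤ (τ * 2 ^ (K + 1)) ^ 2 := by gcongr
      have h3 : (τ * 2 ^ (K + 1)) ^ 2 = 4 * (τ * 2 ^ K) ^ 2 * 1 := by ring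
      nlinarith [sq_nonneg τ]
    · rw [if_neg h, mul_zero, add_zero]
      exact ih (not_lt.1 h)

variable {r d : ℕ}

/-- The sum of the norms of the reweighted vectors is bounded, up to truncation at `τ * 2 ^ K`. -/
theorem measure_sum_norm_reweighted_le (hG : PropertyP G) {C : ℝ} (hC : 0 < C)
    (hgrow : ∀ x y, 0 < x → x < y → 0 < G x ∧ G y / G x ≤ C * (y / x) ^ 2)
    (hum : ∀ i, Measurable (u i))
    (hl : ∀ i t, μ.real {ω | u i ω ≤ t} = if 0 ≤ t then 1 - Real.exp (-G t) else 0)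
    (U : Fin r → Fin n → ℝ) (hU : ∀ j, ∑ i, G |U j i| ≤ 1) (hrd : r ≤ d) (hd : 1 ≤ d)
    (hdn : d ≤ n) {K : ℕ} (hK : 1 ≤ K) {T : ℝ} (hT : 100 * (d : ℝ) ≤ T)
    (hTK : T = 1 / n * 2 ^ K) :
    μ.real {ω | (d : ℝ) * (1 + 400 * d * K * (C + T)) <
      (∑ j, ‖WithLp.toLp 2 (fun i => (u i ω)⁻¹ * U j i)‖) ^ 2} ≤ 2 / 100 := by
  have hd' : (1 : ℝ) ≤ d := by exact_mod_cast hd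
  have hdn' : (d : ℝ) ≤ n := by exact_mod_cast hdn
  have hrd' : (r : ℝ) ≤ d := by exact_mod_cast hrd
  have hK' : (1 : ℝ) ≤ K := by exact_mod_cast hK
  have hT0 : 0 < T := by linarith
  have hn0 : (0 : ℝ) < n := by linarith
  let s : ℕ → ℝ := fun k => 1 / n * 2 ^ k
  have hs0 : ∀ k, 0 < s k := fun k => by positivity
  have hsT : ∀ k < K, s k ≤ T := fun k hk => by
    rw [hTK]
    exact mul_le_mul_of_nonneg_left (pow_le_pow_right₀ (by norm_num) hk.le) (by positivity)
  have hE : ∀ j i k, MeasurableSet {ω | s k < |U j i| * (u i ω)⁻¹} := fun j i k =>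
    measurableSet_lt measurable_const ((hum i).inv.const_mul _)
  -- A dyadic majorant of the truncated squares, whose expectation is a sum of tail probabilities.
  let F : Ω → ℝ := fun ω => ∑ j, ∑ i, ∑ k ∈ Finset.range K,
    4 * s k ^ 2 * Set.indicator {ω | s k < |U j i| * (u i ω)⁻¹} 1 ω
  have hint : ∀ j i k, Integrable (fun ω =>
      4 * s k ^ 2 * Set.indicator {ω | s k < |U j i| * (u i ω)⁻¹} (1 : Ω → ℝ) ω) μ :=
    fun j i k => ((integrable_const (1 : ℝ)).indicator (hE j i k)).const_mul _
  have hFint : Integrable F μ := integrable_finsetSum _ fun j _ => integrable_finsetSum _ fun i _ =>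
    integrable_finsetSum _ fun k _ => hint j i k
  have hF0 : ∀ ω, 0 ≤ F ω := fun ω => Finset.sum_nonneg fun j _ => Finset.sum_nonneg fun i _ =>
    Finset.sum_nonneg fun k _ => mul_nonneg (by positivity)
      (Set.indicator_nonneg (fun _ _ => zero_le_one) _)
  have hFle : ∫ ω, F ω ∂μ ≤ 4 * d * K * (C + T) := by
    have h1 : ∫ ω, F ω ∂μ = ∑ j, ∑ i, ∑ k ∈ Finset.range K,
        4 * s k ^ 2 * μ.real {ω | s k < |U j i| * (u i ω)⁻¹} := by
      simp only [F]
      rw [integral_finsetSum _ fun j _ => integrable_finsetSum _ fun i _ =>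
        integrable_finsetSum _ fun k _ => hint j i k]
      refine Finset.sum_congr rfl fun j _ => ?_
      rw [integral_finsetSum _ fun i _ => integrable_finsetSum _ fun k _ => hint j i k]
      refine Finset.sum_congr rfl fun i _ => ?_
      rw [integral_finsetSum _ fun k _ => hint j i k]
      refine Finset.sum_congr rfl fun k _ => ?_
      rw [integral_const_mul, integral_indicator_one (hE j i k)]
    rw [h1]
    calc _ ≤ ∑ j, ∑ i, ∑ k ∈ Finset.range K, 4 * ((C + T) * G |U j i|) := by
          refine Finset.sum_le_sum fun j _ => Finset.sum_le_sum fun i _ =>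
            Finset.sum_le_sum fun k hk => ?_
          rw [mul_assoc]
          refine mul_le_mul_of_nonneg_left ?_ (by norm_num)
          refine le_trans ?_ (hG.sq_mul_map_div_le hC hgrow (abs_nonneg _) (hs0 k)
            (hsT k (Finset.mem_range.1 hk)))
          exact mul_le_mul_of_nonneg_left (measure_lt_mul_inv_le hl i _ (hs0 k)) (by positivity)
      _ = ∑ j, 4 * K * (C + T) * ∑ i, G |U j i| := by
          refine Finset.sum_congr rfl fun j _ => ?_
          rw [Finset.mul_sum]
          refine Finset.sum_congr rfl fun i _ => ?_
          simp only [Finset.sum_const, Finset.card_range, nsmul_eq_mul]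
          ring
      _ ≤ ∑ _j : Fin r, 4 * K * (C + T) * 1 :=
          Finset.sum_le_sum fun j _ => mul_le_mul_of_nonneg_left (hU j) (by positivity)
      _ = r * (4 * K * (C + T)) := by simp
      _ ≤ d * (4 * K * (C + T)) := by gcongr
      _ = _ := by ring
  have hF : μ.real {ω | 400 * d * K * (C + T) ≤ F ω} ≤ 1 / 100 := by
    have := mul_meas_ge_le_integral_of_nonneg (Eventually.of_forall hF0) hFint
      (400 * d * K * (C + T))
    have h0 : 0 < 400 * d * K * (C + T) := by positivity
    by_contra! h
    nlinarith
  -- Exceeding `T ≥ 1` costs `∑ G (|Uⱼᵢ| / T) ≤ 1 / T` per basis vector; there are at most `d` of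
  -- them and `T ≥ 100 d`.
  have hbig : μ.real (⋃ j, ⋃ i, {ω | T < |U j i| * (u i ω)⁻¹}) ≤ 1 / 100 := by
    have h1 : ∀ j, μ.real (⋃ i, {ω | T < |U j i| * (u i ω)⁻¹}) ≤ 1 / T := by
      intro j
      refine (measureReal_iUnion_fintype_le _).trans ?_
      rw [le_div_iff₀ hT0, Finset.sum_mul]
      refine (Finset.sum_le_sum fun i _ => ?_).trans (hU j)
      rw [mul_comm]
      refine le_trans ?_ (hG.map_div_le (abs_nonneg _) (by linarith : 1 ≤ T))
      exact mul_le_mul_of_nonneg_left (measure_lt_mul_inv_le hl i _ hT0) hT0.le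
    refine (measureReal_iUnion_fintype_le _).trans ((Finset.sum_le_sum fun j _ => h1 j).trans ?_)
    simp only [Finset.sum_const, Finset.card_univ, Fintype.card_fin, nsmul_eq_mul]
    rw [mul_one_div, div_le_div_iff₀ hT0 (by norm_num)]
    linarith
  have hpos : μ.real {ω | ¬ ∀ i, 0 < u i ω} = 0 := by
    rw [measureReal_eq_zero_iff]
    exact ae_iff.1 (ae_weights_pos hG hl)
  refine (measureReal_mono (s₂ := {ω | 400 * d * K * (C + T) ≤ F ω} ∪
    ((⋃ j, ⋃ i, {ω | T < |U j i| * (u i ω)⁻¹}) ∪ {ω | ¬ ∀ i, 0 < u i ω})) ?_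
    (measure_ne_top _ _)).trans ((measureReal_union_le _ _).trans ?_)
  · intro ω hω
    by_contra hgood
    simp only [Set.mem_union, Set.mem_ofPred_eq, Set.mem_iUnion, not_or, not_exists, not_not,
      not_le, not_lt] at hgood hω
    obtain ⟨h1, h2, h3⟩ := hgood
    have h4 : ∑ j, ‖WithLp.toLp 2 (fun i => (u i ω)⁻¹ * U j i)‖ ^ 2 ≤ 1 + F ω := by
      have h5 : ∀ j i, ((u i ω)⁻¹ * U j i) ^ 2 ≤ (1 / n : ℝ) ^ 2 + ∑ k ∈ Finset.range K,
          4 * s k ^ 2 * Set.indicator {ω | s k < |U j i| * (u i ω)⁻¹} 1 ω := by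
        intro j i
        have h6 := sq_le_dyadic_sum (τ := 1 / n) (w := |U j i| * (u i ω)⁻¹)
          (mul_nonneg (abs_nonneg _) (inv_nonneg.2 (h3 i).le)) K (hTK ▸ h2 j i)
        rw [show ((u i ω)⁻¹ * U j i) ^ 2 = (|U j i| * (u i ω)⁻¹) ^ 2 by
          rw [mul_pow, mul_pow, sq_abs, mul_comm]]
        refine h6.trans (le_of_eq ?_)
        congr 1
      calc ∑ j, ‖WithLp.toLp 2 (fun i => (u i ω)⁻¹ * U j i)‖ ^ 2
          ≤ ∑ j, ∑ i, ((1 / n : ℝ) ^ 2 + ∑ k ∈ Finset.range K,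
            4 * s k ^ 2 * Set.indicator {ω | s k < |U j i| * (u i ω)⁻¹} 1 ω) := by
            refine Finset.sum_le_sum fun j _ => ?_
            rw [norm_toLp_sq]
            exact Finset.sum_le_sum fun i _ => h5 j i
        -- The lowest scale `1 / n` is chosen so that its total contribution is `r / n ≤ 1`.
        _ = r * (n * (1 / n : ℝ) ^ 2) + F ω := by
            simp only [Finset.sum_add_distrib, F]
            simp
        _ ≤ 1 + F ω := by
            gcongr
            have : r * (n * (1 / n : ℝ) ^ 2) = r / n := by field_simp
            rw [this, div_le_one hn0]
            linarith
    -- Cauchy–Schwarz passes from the sum of squared norms to the squared sum of norms, at the cost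
    -- of a factor `d`.
    have h7 := sq_sum_le_card_mul_sum_sq (s := Finset.univ)
      (f := fun j => ‖WithLp.toLp 2 (fun i => (u i ω)⁻¹ * U j i)‖)
    simp only [Finset.card_univ, Fintype.card_fin] at h7
    have h8 : (r : ℝ) * ∑ j, ‖WithLp.toLp 2 (fun i => (u i ω)⁻¹ * U j i)‖ ^ 2 ≤ d * (1 + F ω) :=
      mul_le_mul hrd' h4 (Finset.sum_nonneg fun j _ => sq_nonneg _) (by linarith)
    have h9 : (d : ℝ) * (1 + F ω) ≤ d * (1 + 400 * d * K * (C + T)) := by gcongr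
    linarith
  · have := measureReal_union_le (μ := μ) (⋃ j, ⋃ i, {ω | T < |U j i| * (u i ω)⁻¹})
      {ω | ¬ ∀ i, 0 < u i ω}
    linarith

/-- The small-ball estimate for the largest reweighted coordinate. -/
theorem measure_forall_mul_inv_lt_le (hG : PropertyP G) (hum : ∀ i, Measurable (u i))
    (hl : ∀ i t, μ.real {ω | u i ω ≤ t} = if 0 ≤ t then 1 - Real.exp (-G t) else 0)
    (hi : iIndepFun u μ) {a l : ℝ} (ha : 0 < a) (hl1 : 1 ≤ l) (y : Fin n → ℝ)
    (hy : a < orliczNorm G y) :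
    μ.real {ω | ∀ i, |y i| * (u i ω)⁻¹ < a / l} ≤ Real.exp (-l) := by
  have hl0 : 0 < l := by linarith
  have hae : {ω | ∀ i, |y i| * (u i ω)⁻¹ < a / l} ≤ᵐ[μ]
      (⋂ i, u i ⁻¹' Set.Ioi (l * (|y i| / a)) : Set Ω) := by
    filter_upwards [ae_weights_pos hG hl] with ω hω h
    refine Set.mem_iInter.2 fun i => ?_
    have h1 := h i
    rw [← div_eq_mul_inv, div_lt_div_iff₀ (hω i) hl0] at h1
    rw [Set.mem_preimage, Set.mem_Ioi, ← mul_div_assoc, div_lt_iff₀ ha]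
    linarith
  -- This is where the law `1 - exp (-G)` pays off: the product of the tails is the exponential of
  -- the Orlicz sum.
  have h1 : μ (⋂ i, u i ⁻¹' Set.Ioi (l * (|y i| / a))) =
      ∏ i, μ (u i ⁻¹' Set.Ioi (l * (|y i| / a))) :=
    hi.meas_iInter fun i => ⟨_, measurableSet_Ioi, rfl⟩
  have h2 : ∀ i, μ.real (u i ⁻¹' Set.Ioi (l * (|y i| / a))) = Real.exp (-G (l * (|y i| / a))) := by
    intro i
    have h3 : u i ⁻¹' Set.Ioi (l * (|y i| / a)) = {ω | u i ω ≤ l * (|y i| / a)}ᶜ := by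
      ext ω; simp
    rw [h3, probReal_compl_eq_one_sub (measurableSet_le (hum i) measurable_const), hl,
      if_pos (by positivity)]
    ring
  calc μ.real {ω | ∀ i, |y i| * (u i ω)⁻¹ < a / l}
      ≤ μ.real (⋂ i, u i ⁻¹' Set.Ioi (l * (|y i| / a))) :=
        ENNReal.toReal_mono (measure_ne_top _ _) (measure_mono_ae hae)
    _ = ∏ i, μ.real (u i ⁻¹' Set.Ioi (l * (|y i| / a))) := by
        rw [measureReal_def, h1, ENNReal.toReal_prod]; rfl
    _ = Real.exp (-∑ i, G (l * (|y i| / a))) := by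
        simp only [h2]
        rw [← Real.exp_sum, Finset.sum_neg_distrib]
    _ ≤ Real.exp (-l) := by
        rw [Real.exp_le_exp, neg_le_neg_iff]
        calc l = l * 1 := by ring
          _ ≤ l * ∑ i, G (|y i| / a) := by
              gcongr; exact (one_lt_sum_of_lt_orliczNorm ha hy).le
          _ ≤ ∑ i, G (l * (|y i| / a)) := by
              rw [Finset.mul_sum]
              exact Finset.sum_le_sum fun i _ => hG.mul_le_map_mul hl1 (by positivity)

end ReciprocalWeights

/-! ### Truncation level, grid, and the reweighting theorem -/

theorem half_le_log_natCast {n : ℕ} (hn : 2 ≤ n) : 1 / 2 ≤ Real.log n := by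
  have h1 : Real.log 2 ≤ Real.log n :=
    Real.log_le_log (by norm_num) (by exact_mod_cast hn)
  linarith [Real.log_two_gt_d9]

/-- Take `K = ⌈log₂ (100 d n)⌉`, which is off by at most a factor `2`. Then `2 ^ K ≤ 200 d n ≤ n ^
10`, and `10 / log 2 < 15`. -/
theorem exists_dyadic_truncation {n d : ℕ} (hn : 2 ≤ n) (hd : 1 ≤ d) (hdn : d ≤ n) :
    ∃ K : ℕ, 1 ≤ K ∧ 100 * (d : ℝ) ≤ 1 / n * 2 ^ K ∧ 1 / (n : ℝ) * 2 ^ K ≤ 200 * d ∧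
      (K : ℝ) ≤ 15 * Real.log n := by
  have hn0 : (0 : ℝ) < n := by exact_mod_cast (by omega : 0 < n)
  have hdn0 : 1 < 100 * d * n := by nlinarith
  have h1 : 100 * d * n ≤ 2 ^ Nat.clog 2 (100 * d * n) := Nat.le_pow_clog (by norm_num) _
  have h2 : 2 ^ (Nat.clog 2 (100 * d * n)).pred < 100 * d * n :=
    Nat.pow_pred_clog_lt_self (by norm_num) hdn0
  have h3 : 0 < Nat.clog 2 (100 * d * n) := Nat.clog_pos (by norm_num) hdn0
  obtain ⟨k, hk⟩ := Nat.exists_eq_succ_of_ne_zero h3.ne'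
  rw [hk] at h1 h2
  simp only [Nat.succ_eq_add_one, Nat.pred_succ] at h1 h2
  have h4 : 2 ^ (k + 1) ≤ 200 * d * n := by rw [pow_succ]; nlinarith
  have h1' : (100 * d * n : ℝ) ≤ 2 ^ (k + 1) := by exact_mod_cast h1
  have h4' : (2 : ℝ) ^ (k + 1) ≤ 200 * d * n := by exact_mod_cast h4
  refine ⟨k + 1, by omega, ?_, ?_, ?_⟩
  · rw [one_div_mul_eq_div, le_div_iff₀ hn0]; exact h1'
  · rw [one_div_mul_eq_div, div_le_iff₀ hn0]; exact h4'
  · have h5 : (2 : ℝ) ^ (k + 1) ≤ (n : ℝ) ^ 10 := by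
      have hn2 : (2 : ℝ) ≤ n := by exact_mod_cast hn
      have hdn' : (d : ℝ) ≤ n := by exact_mod_cast hdn
      have h6 : (2 : ℝ) ^ 8 ≤ (n : ℝ) ^ 8 := by gcongr
      calc (2 : ℝ) ^ (k + 1) ≤ 200 * d * n := h4'
        _ ≤ 2 ^ 8 * n * n := by gcongr; norm_num
        _ ≤ (n : ℝ) ^ 8 * n * n := by gcongr
        _ = (n : ℝ) ^ 10 := by ring
    have h6 := Real.log_le_log (by positivity) h5
    rw [Real.log_pow, Real.log_pow] at h6
    have h7 := Real.log_two_gt_d9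
    have h8 : (0 : ℝ) ≤ ((k + 1 : ℕ) : ℝ) := by positivity
    push_cast at h6 ⊢
    nlinarith

/-- The left side is only of order `d ^ 3 l`; since `l ≥ 1 / 2` and `d ≥ 1`, it fits below the
square with room to spare. -/
theorem truncation_bound_le {C : ℝ} (hC : 0 < C) {d K T l : ℝ} (hd : 1 ≤ d) (hl : 1 / 2 ≤ l)
    (hT : T ≤ 200 * d) (hT0 : 0 ≤ T) (hK : K ≤ 15 * l) :
    d * (1 + 400 * d * K * (C + T)) ≤ ((4 + 12000 * (C + 200)) * d ^ 2 * l) ^ 2 := by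
  have hd0 : 0 ≤ d := by linarith
  -- Half of `12000` is `400 * 15`; half of `4` absorbs the summand `1`, through `1 ≤ 2 l d ^ 2`.
  set Q := 4 + 12000 * (C + 200) with hQ
  have h1 : 400 * d * K * (C + T) ≤ 400 * d * (15 * l) * (d * (C + 200)) := by
    gcongr
    nlinarith
  have h2 : 1 ≤ 2 * l * d ^ 2 := by nlinarith [sq_nonneg d]
  have h3 : 1 + 400 * d * K * (C + T) ≤ d ^ 2 * l * (Q / 2) := by
    have : 400 * d * (15 * l) * (d * (C + 200)) = d ^ 2 * l * (Q / 2) - 2 * l * d ^ 2 := by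
      rw [hQ]; ring
    linarith
  have hQ1 : 1 ≤ Q := by rw [hQ]; linarith
  calc d * (1 + 400 * d * K * (C + T)) ≤ d * (d ^ 2 * l * (Q / 2)) := by gcongr
    _ = d ^ 3 * l * (1 / 2) * Q := by ring
    _ ≤ d ^ 4 * l * l * Q ^ 2 := by
        gcongr
        · norm_num
        · nlinarith
    _ = (Q * d ^ 2 * l) ^ 2 := by ring

/-- A seminorm `q` is comparable to `p` on a subspace if it is bounded below on the points of a
fine grid. -/
theorem seminorm_bounds_of_grid {E : Type*} [AddCommGroup E] [Module ℝ E] (p q : Seminorm ℝ E)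
    {r : ℕ} (U : Fin r → E) (hU : ∀ j, p (U j) ≤ 1 / 2) (V : Submodule ℝ E)
    (hV : ∀ y ∈ V, ∃ c : Fin r → ℝ, y = ∑ j, c j • U j ∧ ∀ j, |c j| ≤ 2 * p y) {R b : ℝ}
    (hR : ∑ j, q (U j) ≤ R) {M : ℕ} (hM : 1 ≤ M) (hrM : r ≤ M) (hRb : R ≤ M * b)
    (hgrid : ∀ z : Fin r → ℤ, (∀ j, z j ∈ Finset.Icc (-(3 * M : ℤ)) (3 * M)) →
      1 / 2 ≤ p (∑ j, ((z j : ℝ) / M) • U j) → b ≤ q (∑ j, ((z j : ℝ) / M) • U j)) :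
    ∀ y ∈ V, b / 2 * p y ≤ q y ∧ q y ≤ 2 * R * p y := by
  have hM' : (1 : ℝ) ≤ M := by exact_mod_cast hM
  have hM0 : (0 : ℝ) < M := by linarith
  have hrM' : (r : ℝ) ≤ M := by exact_mod_cast hrM
  have bound : ∀ (s : Seminorm ℝ E) (c : Fin r → ℝ) (B : ℝ), (∀ j, |c j| ≤ B) →
      s (∑ j, c j • U j) ≤ B * ∑ j, s (U j) := by
    intro s c B hc
    rw [Finset.mul_sum]
    refine (Finset.le_sum_of_subadditive s (map_zero s).le (map_add_le_add s) _ _).trans (Finset.sum_le_sum fun j _ => ?_)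
    rw [map_smul_eq_mul, Real.norm_eq_abs]
    exact mul_le_mul_of_nonneg_right (hc j) (apply_nonneg s _)
  -- By homogeneity `p y = 1` suffices. Rounding the coefficients to multiples of `1 / M` moves `p`
  -- by at most `1 / 4` and `q` by at most `R / (2 M) ≤ b / 2`, so the bound `b` at the grid point
  -- survives by half.
  have lower : ∀ y ∈ V, p y = 1 → b / 2 ≤ q y := by
    intro y hy hy1
    obtain ⟨c, hyc, hc⟩ := hV y hy
    let z : Fin r → ℤ := fun j => round (M * c j)
    have hz : ∀ j, |(M : ℝ) * c j - z j| ≤ 1 / 2 := fun j => abs_sub_round _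
    have hzc : ∀ j, |c j - (z j : ℝ) / M| ≤ 1 / (2 * M) := by
      intro j
      have : c j - (z j : ℝ) / M = (M * c j - z j) / M := by field_simp
      rw [this, abs_div, abs_of_pos hM0, div_le_div_iff₀ hM0 (by positivity)]
      nlinarith [hz j]
    -- Coefficients are at most `2` in absolute value, so the rounded numerators are at most `2 M +
    -- 1 / 2 ≤ 3 M`.
    have hz3 : ∀ j, z j ∈ Finset.Icc (-(3 * M : ℤ)) (3 * M) := by
      intro j
      have h1 := abs_le.1 (hz j)
      have h2 := abs_le.1 (hc j)
      rw [hy1] at h2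
      rw [Finset.mem_Icc]
      constructor
      · have : -(3 * M : ℝ) ≤ z j := by nlinarith
        exact_mod_cast this
      · have : (z j : ℝ) ≤ 3 * M := by nlinarith
        exact_mod_cast this
    have hdiff : y - ∑ j, ((z j : ℝ) / M) • U j = ∑ j, (c j - (z j : ℝ) / M) • U j := by
      rw [hyc, ← Finset.sum_sub_distrib]
      exact Finset.sum_congr rfl fun j _ => (sub_smul _ _ _).symm
    have hp := bound p _ _ hzc
    have hq := bound q _ _ hzc
    rw [← hdiff] at hp hq
    have hpU : ∑ j, p (U j) ≤ r * (1 / 2) := by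
      refine (Finset.sum_le_sum fun j _ => hU j).trans ?_
      simp
    have hp2 : p (y - ∑ j, ((z j : ℝ) / M) • U j) ≤ 1 / 2 := by
      calc _ ≤ 1 / (2 * M) * ∑ j, p (U j) := hp
        _ ≤ 1 / (2 * M) * (M * (1 / 2)) := by gcongr; exact hpU.trans (by gcongr)
        _ = 1 / 4 := by field_simp; norm_num
        _ ≤ 1 / 2 := by norm_num
    have hq2 : q (y - ∑ j, ((z j : ℝ) / M) • U j) ≤ b / 2 := by
      calc _ ≤ 1 / (2 * M) * ∑ j, q (U j) := hq
        _ ≤ 1 / (2 * M) * (M * b) := by gcongr; exact hR.trans hRb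
        _ = b / 2 := by field_simp
    have hp3 : p y ≤ p (∑ j, ((z j : ℝ) / M) • U j) + p (y - ∑ j, ((z j : ℝ) / M) • U j) := by
      simpa using map_add_le_add p (∑ j, ((z j : ℝ) / M) • U j) (y - ∑ j, ((z j : ℝ) / M) • U j)
    have hq3 : q (∑ j, ((z j : ℝ) / M) • U j) ≤ q y + q (y - ∑ j, ((z j : ℝ) / M) • U j) := by
      have := map_add_le_add q y (∑ j, ((z j : ℝ) / M) • U j - y)
      rw [map_sub_rev q _ y] at this
      simpa using this
    have := hgrid z hz3 (by linarith)
    linarith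
  intro y hy
  obtain ⟨c, hyc, hc⟩ := hV y hy
  constructor
  · rcases (apply_nonneg p y).eq_or_lt with h0 | h0
    · rw [← h0, mul_zero]; exact apply_nonneg q y
    · have h1 := lower ((p y)⁻¹ • y) (V.smul_mem _ hy) (by
        rw [map_smul_eq_mul, norm_inv, Real.norm_eq_abs, abs_of_pos h0, inv_mul_cancel₀ h0.ne'])
      rw [map_smul_eq_mul, norm_inv, Real.norm_eq_abs, abs_of_pos h0, ← div_eq_inv_mul,
        le_div_iff₀ h0] at h1
      exact h1
  · have h1 := bound q c _ hc
    rw [← hyc] at h1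
    calc q y ≤ 2 * p y * ∑ j, q (U j) := h1
      _ ≤ 2 * p y * R := by
          gcongr
      _ = 2 * R * p y := by ring

/-- The euclidean norm of the coordinatewise product with fixed weights. -/
noncomputable def weightedSeminorm {n : ℕ} (v : Fin n → ℝ) : Seminorm ℝ (Fin n → ℝ) :=
  (normSeminorm ℝ (EuclideanSpace ℝ (Fin n))).comp
    ((WithLp.linearEquiv 2 ℝ (Fin n → ℝ)).symm.toLinearMap.comp
      (Matrix.diagonal v).mulVecLin)

theorem weightedSeminorm_apply {n : ℕ} (v y : Fin n → ℝ) :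
    weightedSeminorm v y = ‖WithLp.toLp 2 (fun i => v i * y i)‖ := by
  have : (Matrix.diagonal v).mulVec y = fun i => v i * y i := by
    ext i; exact Matrix.mulVec_diagonal _ _ _
  rw [← this]
  rfl

theorem le_weightedSeminorm {n : ℕ} (v y : Fin n → ℝ) (i : Fin n) :
    |y i| * v i ≤ weightedSeminorm v y := by
  rw [weightedSeminorm_apply]
  refine le_trans ?_ (PiLp.norm_apply_le (WithLp.toLp 2 fun i => v i * y i) i)
  rw [Real.norm_eq_abs, abs_mul, mul_comm]
  exact mul_le_mul_of_nonneg_right (le_abs_self _) (abs_nonneg _)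

/-- A basis of a subspace that is well-conditioned for the Orlicz norm. -/
theorem PropertyP.exists_basis {G : ℝ → ℝ} (hG : PropertyP G) {n : ℕ}
    (V : Submodule ℝ (Fin n → ℝ)) :
    ∃ U : Fin (Module.finrank ℝ V) → Fin n → ℝ, (∀ j, orliczNorm G (U j) ≤ 1 / 2) ∧
      ∀ y ∈ V, ∃ c : Fin (Module.finrank ℝ V) → ℝ,
        y = ∑ j, c j • U j ∧ ∀ j, |c j| ≤ 2 * orliczNorm G y := by
  obtain ⟨b, hb1, hb2⟩ := exists_auerbach_basis ((hG.orliczSeminorm n).comp V.subtype)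
    (by
      have := (hG.continuous_orliczNorm (n := n)).comp (continuous_subtype_val : Continuous fun v : V => (v : Fin n → ℝ))
      simp only [hG.orliczNorm_eq] at this
      exact this) one_pos
    (fun x => by
      rw [one_mul, Submodule.coe_norm, pi_norm_le_iff_of_nonneg (apply_nonneg _ _)]
      intro i
      have := hG.abs_le_orliczNorm (x : Fin n → ℝ) i
      rwa [hG.orliczNorm_eq] at this)
  -- The Auerbach basis is halved to make the norms strictly less than `1`; the coefficients double
  -- in return.
  refine ⟨fun j => (1 / 2 : ℝ) • (b j : Fin n → ℝ), fun j => ?_, fun y hy => ?_⟩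
  · have := hb1 j
    simp only [Seminorm.comp_apply, Submodule.subtype_apply] at this
    rw [hG.orliczNorm_eq, map_smul_eq_mul]
    norm_num
    linarith
  · refine ⟨fun j => 2 * b.repr ⟨y, hy⟩ j, ?_, fun j => ?_⟩
    · have := congrArg (fun v : V => (v : Fin n → ℝ)) (b.sum_repr ⟨y, hy⟩)
      simp only [Submodule.coe_sum, Submodule.coe_smul] at this
      refine this.symm.trans (Finset.sum_congr rfl fun j _ => ?_)
      rw [smul_smul]
      congr 1
      ring
    · have := hb2 ⟨y, hy⟩ j
      simp only [Seminorm.comp_apply, Submodule.subtype_apply] at this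
      rw [abs_mul, abs_two, hG.orliczNorm_eq]
      linarith

/-- The resolution of the grid used for the lower bound. -/
noncomputable def gridResolution (Q : ℝ) (n : ℕ) : ℕ := ⌈4 * (10 ^ 6 * Q) * Q⌉₊ * n ^ 5

/-- The condition `R ≤ M b` of the grid argument, with `R` the upper bound and `b` the small-ball
level. The power `n ^ 5` pays for `d ^ 3 (log n) ^ 2`. -/
theorem gridResolution_ge {Q : ℝ} (hQ : 1 ≤ Q) {n d : ℕ} (hn : 2 ≤ n) (hd : 1 ≤ d) (hdn : d ≤ n) :
    Q * d ^ 2 * Real.log n ≤ gridResolution Q n * (1 / 4 / (10 ^ 6 * Q * d * Real.log n)) := by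
  have hl := half_le_log_natCast hn
  have hln : Real.log n ≤ n := Real.log_le_self (by positivity)
  set l := Real.log n
  have hd' : (1 : ℝ) ≤ d := by exact_mod_cast hd
  have hdn' : (d : ℝ) ≤ n := by exact_mod_cast hdn
  have h0 : 0 < 10 ^ 6 * Q * d * l := by positivity
  rw [div_div, mul_one_div, le_div_iff₀ (by positivity), gridResolution]
  push_cast
  calc Q * d ^ 2 * l * (4 * (10 ^ 6 * Q * d * l)) = 4 * (10 ^ 6 * Q) * Q * (d ^ 3 * l ^ 2) := by
        ring
    _ ≤ ⌈4 * (10 ^ 6 * Q) * Q⌉₊ * ((n : ℝ) ^ 3 * n ^ 2) := by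
        gcongr
        exact Nat.le_ceil _
    _ = _ := by ring

theorem le_gridResolution {Q : ℝ} (hQ : 1 ≤ Q) {n : ℕ} (hn : 2 ≤ n) : n ≤ gridResolution Q n := by
  have h1 : 1 ≤ ⌈4 * (10 ^ 6 * Q) * Q⌉₊ := Nat.one_le_ceil_iff.2 (by positivity)
  calc n = 1 * n ^ 1 := by ring
    _ ≤ ⌈4 * (10 ^ 6 * Q) * Q⌉₊ * n ^ 5 :=
      Nat.mul_le_mul h1 (Nat.pow_le_pow_right (by omega) (by norm_num))

/-- The grid has at most `(7 M) ^ d` points with `M` polynomial in `n`, so the logarithm of its size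
is `O(d log n)` and the large constant in the exponent wins. This count dictates the loss in the
lower bound. -/
theorem grid_card_mul_exp_le {Q : ℝ} (hQ : 1 ≤ Q) {n d r : ℕ} (hn : 2 ≤ n) (hd : 1 ≤ d)
    (hrd : r ≤ d) :
    ((Fintype.piFinset fun _ : Fin r => Finset.Icc (-(3 * (gridResolution Q n) : ℤ))
      (3 * (gridResolution Q n))).card : ℝ) * Real.exp (-(10 ^ 6 * Q * d * Real.log n)) ≤
      1 / 100 := by
  have hM := le_gridResolution hQ hn
  have hl := half_le_log_natCast hn
  have hn0 : (0 : ℝ) < n := by exact_mod_cast (by omega : 0 < n)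
  set M := gridResolution Q n with hMdef
  have hM1 : 1 ≤ M := by omega
  have hcard : (Fintype.piFinset fun _ : Fin r => Finset.Icc (-(3 * M : ℤ)) (3 * M)).card ≤
      (7 * M) ^ d := by
    rw [Fintype.card_piFinset]
    simp only [Int.card_Icc, Finset.prod_const, Finset.card_univ, Fintype.card_fin]
    calc (3 * (M : ℤ) + 1 - -(3 * M)).toNat ^ r ≤ (7 * M) ^ r :=
          Nat.pow_le_pow_left (by omega) _
      _ ≤ (7 * M) ^ d := Nat.pow_le_pow_right (by omega) hrd
  have hcard' : ((Fintype.piFinset fun _ : Fin r =>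
      Finset.Icc (-(3 * M : ℤ)) (3 * M)).card : ℝ) ≤ (7 * M) ^ d := by exact_mod_cast hcard
  have hceil : (⌈4 * (10 ^ 6 * Q) * Q⌉₊ : ℝ) ≤ 5 * (10 ^ 6 * Q ^ 2) := by
    have h := (Nat.ceil_lt_add_one (show 0 ≤ 4 * (10 ^ 6 * Q) * Q by positivity)).le
    nlinarith
  have hJ : 700 * (M : ℝ) ≤ Real.exp (10 ^ 6 * Q * Real.log n) := by
    have h1 : 700 * (M : ℝ) ≤ (60000 * Q) ^ 2 * n ^ 5 := by
      rw [hMdef, gridResolution]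
      push_cast
      calc 700 * ((⌈4 * (10 ^ 6 * Q) * Q⌉₊ : ℝ) * n ^ 5) ≤
            700 * ((5 * (10 ^ 6 * Q ^ 2)) * n ^ 5) := by gcongr
        _ = 3500000000 * (Q ^ 2 * n ^ 5) := by ring
        _ ≤ 3600000000 * (Q ^ 2 * n ^ 5) := by gcongr; norm_num
        _ = _ := by ring
    have h2 : (60000 * Q) ≤ Real.exp (60000 * Q) := by
      linarith [Real.add_one_le_exp (60000 * Q)]
    calc 700 * (M : ℝ) ≤ (60000 * Q) ^ 2 * n ^ 5 := h1
      _ ≤ Real.exp (60000 * Q) ^ 2 * Real.exp (Real.log n) ^ 5 := by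
          rw [Real.exp_log hn0]; gcongr
      _ = Real.exp (120000 * Q + 5 * Real.log n) := by
          rw [← Real.exp_nat_mul, ← Real.exp_nat_mul, ← Real.exp_add]
          congr 1; push_cast; ring
      _ ≤ Real.exp (10 ^ 6 * Q * Real.log n) := by
          rw [Real.exp_le_exp]
          nlinarith
  have hd0 : (100 : ℝ) ≤ 100 ^ d := by
    calc (100 : ℝ) = 100 ^ 1 := by norm_num
      _ ≤ 100 ^ d := pow_le_pow_right₀ (by norm_num) hd
  have hfin : 100 * (7 * (M : ℝ)) ^ d ≤ Real.exp (10 ^ 6 * Q * d * Real.log n) := by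
    calc 100 * (7 * (M : ℝ)) ^ d ≤ 100 ^ d * (7 * (M : ℝ)) ^ d := by gcongr
      _ = (700 * (M : ℝ)) ^ d := by rw [← mul_pow]; congr 1; ring
      _ ≤ Real.exp (10 ^ 6 * Q * Real.log n) ^ d := by gcongr
      _ = _ := by rw [← Real.exp_nat_mul]; congr 1; ring
  rw [Real.exp_neg, ← div_eq_mul_inv, div_le_div_iff₀ (Real.exp_pos _) (by norm_num)]
  linarith

/-- Reweighting by the inverses of the random weights changes the Orlicz norm on a
`d`-dimensional subspace into the euclidean norm up to factors `O(d log n)` and `O(d ^ 2 log n)`. -/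
theorem PropertyP.exists_reweighting_bounds {G : ℝ → ℝ} (hG : PropertyP G) :
    ∃ Q : ℝ, 1 ≤ Q ∧ ∀ n d : ℕ, 2 ≤ n → 1 ≤ d → d ≤ n → ∀ (A : Matrix (Fin n) (Fin d) ℝ)
      (Ω : Type*) [MeasurableSpace Ω] (μ : Measure Ω) [IsProbabilityMeasure μ]
      (u : Fin n → Ω → ℝ), (∀ i, Measurable (u i)) →
      (∀ i t, μ.real {ω | u i ω ≤ t} = if 0 ≤ t then 1 - Real.exp (-G t) else 0) →
      iIndepFun u μ →
      μ.real {ω | ∃ x, ‖WithLp.toLp 2 (fun i => (u i ω)⁻¹ * A.mulVec x i)‖ <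
          1 / (8 * 10 ^ 6 * (Q * d * Real.log n)) * orliczNorm G (A.mulVec x) ∨
        2 * (Q * d ^ 2 * Real.log n) * orliczNorm G (A.mulVec x) <
          ‖WithLp.toLp 2 (fun i => (u i ω)⁻¹ * A.mulVec x i)‖} ≤ 3 / 100 := by
  obtain ⟨C, hC, hgrow⟩ := hG.growth
  refine ⟨4 + 12000 * (C + 200), by linarith, ?_⟩
  intro n d hn hd hdn A Ω _ μ _ u hum hlu hiu
  set Q := 4 + 12000 * (C + 200) with hQdef
  have hQ : 1 ≤ Q := by rw [hQdef]; linarith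
  have hl := half_le_log_natCast hn
  have hd' : (1 : ℝ) ≤ d := by exact_mod_cast hd
  let V := LinearMap.range A.mulVecLin
  obtain ⟨U, hU, hV⟩ := hG.exists_basis V
  have hrd : Module.finrank ℝ V ≤ d := by
    simpa using LinearMap.finrank_range_le A.mulVecLin
  generalize Module.finrank ℝ V = r at U hU hV hrd
  have hUG : ∀ j, ∑ i, G |U j i| ≤ 1 := fun j =>
    hG.sum_map_le_one (lt_of_le_of_lt (hU j) (by norm_num))
  obtain ⟨K, hK1, hT100, hT200, hKl⟩ := exists_dyadic_truncation hn hd hdn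
  have hE1 := measure_sum_norm_reweighted_le hG hC hgrow hum hlu U hUG hrd hd hdn hK1 hT100 rfl
  have htr := truncation_bound_le hC hd' hl hT200 (by positivity) hKl
  rw [← hQdef] at htr
  set l := Real.log n with hldef
  set M := gridResolution Q n with hMdef
  -- The exponent of the small-ball estimate, large enough for the union bound over the grid.
  let lam := 10 ^ 6 * Q * d * l
  have hlam : 1 ≤ lam := by
    have h1 : 1 ≤ Q * d := one_le_mul_of_one_le_of_one_le hQ hd'
    have h2 : lam = 10 ^ 6 * (Q * d) * l := by simp only [lam]; ring
    rw [h2]; nlinarith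
  let pt : (Fin r → ℤ) → Fin n → ℝ := fun z => ∑ j, ((z j : ℝ) / M) • U j
  let grid := Fintype.piFinset fun _ : Fin r => Finset.Icc (-(3 * M : ℤ)) (3 * M)
  -- The first condition is deterministic: grid points of small norm have an empty bad event. The
  -- level `1 / 4` is strictly below `1 / 2`, as the small-ball estimate requires.
  let bad : (Fin r → ℤ) → Set Ω := fun z => {ω | 1 / 2 ≤ orliczNorm G (pt z) ∧
    ∀ i, |pt z i| * (u i ω)⁻¹ < 1 / 4 / lam}
  have hbad : ∀ z, μ.real (bad z) ≤ Real.exp (-lam) := by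
    intro z
    by_cases hz : 1 / 2 ≤ orliczNorm G (pt z)
    · refine le_trans (measureReal_mono fun ω hω => hω.2)
        (measure_forall_mul_inv_lt_le hG hum hlu hiu (by norm_num) hlam (pt z) ?_)
      linarith
    · simp only [bad, hz, false_and]
      simp [Real.exp_nonneg]
  refine (measureReal_mono (s₂ := {ω | (d : ℝ) * (1 + 400 * d * K * (C + 1 / n * 2 ^ K)) <
      (∑ j, ‖WithLp.toLp 2 (fun i => (u i ω)⁻¹ * U j i)‖) ^ 2} ∪ ⋃ z ∈ grid, bad z) ?_
      (measure_ne_top _ _)).trans ((measureReal_union_le _ _).trans ?_)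
  · rintro ω ⟨x, hx⟩
    by_contra hgood
    simp only [Set.mem_union, Set.mem_ofPred_eq, Set.mem_iUnion, not_or, exists_prop, not_exists,
      not_and, not_lt, bad] at hgood
    obtain ⟨h1, h2⟩ := hgood
    have hR : ∑ j, weightedSeminorm (fun i => (u i ω)⁻¹) (U j) ≤ Q * d ^ 2 * l := by
      simp only [weightedSeminorm_apply]
      exact (abs_le_of_sq_le_sq' (h1.trans htr) (by positivity)).2
    have key := seminorm_bounds_of_grid (hG.orliczSeminorm n)
      (weightedSeminorm fun i => (u i ω)⁻¹) U (fun j => by rw [← hG.orliczNorm_eq]; exact hU j) V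
      (fun y hy => by rw [← hG.orliczNorm_eq]; exact hV y hy) hR (M := M) (b := 1 / 4 / lam)
      (by have := le_gridResolution hQ hn; omega)
      (by have := le_gridResolution hQ hn; omega)
      (gridResolution_ge hQ hn hd hdn)
      (fun z hz hz2 => by
        rw [← hG.orliczNorm_eq] at hz2
        by_contra! hlt
        obtain ⟨i, hi⟩ := not_forall.1 (fun h => h2 z (Fintype.mem_piFinset.2 hz) hz2 h)
        exact hi ((le_weightedSeminorm (fun i => (u i ω)⁻¹) _ i).trans_lt hlt))
      (A.mulVec x) ⟨x, rfl⟩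
    rw [← hG.orliczNorm_eq, weightedSeminorm_apply] at key
    -- The grid argument retains half of the level `1 / 4 / lam`.
    have heq : 1 / (8 * 10 ^ 6 * (Q * d * l)) = 1 / 4 / lam / 2 := by
      simp only [lam]; field_simp; norm_num
    rw [heq] at hx
    rcases hx with hx | hx <;> linarith [key.1, key.2]
  · have h3 : μ.real (⋃ z ∈ grid, bad z) ≤ 1 / 100 := by
      refine (measureReal_biUnion_finset_le _ _).trans
        ((Finset.sum_le_sum fun z _ => hbad z).trans ?_)
      rw [Finset.sum_const, nsmul_eq_mul]
      exact grid_card_mul_exp_le hQ hn hd hrd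
    linarith

/-- A bound for all fibres of an event bounds its probability. -/
theorem ProbabilityTheory.IndepFun.measureReal_le_of_forall {Ω α β : Type*} [MeasurableSpace Ω]
    [MeasurableSpace α] [MeasurableSpace β] {μ : Measure Ω} [IsProbabilityMeasure μ] {X : Ω → α}
    {Y : Ω → β} (hXY : IndepFun X Y μ) (hX : Measurable X) (hY : Measurable Y) {B : Set (α × β)}
    (hB : MeasurableSet B) {δ : ℝ} (h : ∀ x, μ.real {ω | (x, Y ω) ∈ B} ≤ δ) :
    μ.real {ω | (X ω, Y ω) ∈ B} ≤ δ := by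
  have hδ : 0 ≤ δ := by
    obtain ⟨ω⟩ : Nonempty Ω := μ.nonempty_of_neZero
    exact measureReal_nonneg.trans (h (X ω))
  have h1 : μ {ω | (X ω, Y ω) ∈ B} = ((μ.map X).prod (μ.map Y)) B := by
    rw [← (indepFun_iff_map_prod_eq_prod_map_map hX.aemeasurable hY.aemeasurable).1 hXY,
      Measure.map_apply (hX.prodMk hY) hB]
    rfl
  have : IsProbabilityMeasure (μ.map X) := Measure.isProbabilityMeasure_map hX.aemeasurable
  have h2 : ((μ.map X).prod (μ.map Y)) B ≤ ENNReal.ofReal δ := by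
    rw [Measure.prod_apply hB]
    calc ∫⁻ x, (μ.map Y) (Prod.mk x ⁻¹' B) ∂(μ.map X) ≤ ∫⁻ _x, ENNReal.ofReal δ ∂(μ.map X) := by
          refine lintegral_mono fun x => ?_
          rw [Measure.map_apply hY (measurable_prodMk_left hB)]
          exact (ENNReal.le_ofReal_iff_toReal_le (measure_ne_top _ _) hδ).2 (h x)
      _ = ENNReal.ofReal δ := by simp
  rw [measureReal_def, h1]
  exact ENNReal.toReal_le_of_le_ofReal hδ h2

theorem inv_diagonal_eq {n : ℕ} {u : Fin n → ℝ} (hu : ∀ i, u i ≠ 0) :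
    (Matrix.diagonal u)⁻¹ = Matrix.diagonal fun i => (u i)⁻¹ := by
  refine Matrix.inv_eq_right_inv ?_
  rw [Matrix.diagonal_mul_diagonal]
  simp [hu]

/-! ### Conditioning and composition of the embeddings -/

section Sketch

variable {n d t₁ t₂ : ℕ} (A : Matrix (Fin n) (Fin d) ℝ)

/-- The reweighted vector `diag(v) A x`. -/
def reweighted (v : Fin n → ℝ) (x : Fin d → ℝ) : Fin n → ℝ := fun i => v i * A.mulVec x i

theorem mulVec_diagonal_mul (v : Fin n → ℝ) (x : Fin d → ℝ) :
    (Matrix.diagonal v * A).mulVec x = reweighted A v x := by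
  rw [← Matrix.mulVec_mulVec]
  ext i
  exact Matrix.mulVec_diagonal _ _ _

/-- The data on which the sparse embedding fails. -/
def sparseFailure (t₁ : ℕ) : Set ((Fin n → ℝ) × (Fin n → ℝ) × (Fin n → Fin t₁)) :=
  {p | ∃ x, 2 * ‖WithLp.toLp 2 (reweighted A p.1 x)‖ <
      ‖WithLp.toLp 2 ((sparseEmbedding p.2.2 p.2.1).mulVec (reweighted A p.1 x))‖ ∨
    ‖WithLp.toLp 2 ((sparseEmbedding p.2.2 p.2.1).mulVec (reweighted A p.1 x))‖ <
      1 / 2 * ‖WithLp.toLp 2 (reweighted A p.1 x)‖}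

/-- The data on which the Gaussian embedding fails. -/
def gaussianFailure (t₁ t₂ : ℕ) :
    Set ((Fin n → ℝ) × (Fin n → ℝ) × (Fin n → Fin t₁) × (Fin t₂ → Fin t₁ → ℝ)) :=
  {p | ∃ x, 3 * ‖WithLp.toLp 2 ((sparseEmbedding p.2.2.1 p.2.1).mulVec (reweighted A p.1 x))‖ <
      ‖WithLp.toLp 2 ((scaledMatrix p.2.2.2).mulVec
        ((sparseEmbedding p.2.2.1 p.2.1).mulVec (reweighted A p.1 x)))‖ ∨
    ‖WithLp.toLp 2 ((scaledMatrix p.2.2.2).mulVec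
        ((sparseEmbedding p.2.2.1 p.2.1).mulVec (reweighted A p.1 x)))‖ <
      1 / 3 * ‖WithLp.toLp 2 ((sparseEmbedding p.2.2.1 p.2.1).mulVec (reweighted A p.1 x))‖}

variable {A}

theorem continuous_reweighted {X : Type*} [TopologicalSpace X] {v : X → Fin n → ℝ}
    (hv : Continuous v) (x : Fin d → ℝ) : Continuous fun p => reweighted A (v p) x :=
  continuous_pi fun i => ((continuous_apply i).comp hv).mul continuous_const

theorem continuous_sparseEmbedding_mulVec {X : Type*} [TopologicalSpace X] {h : X → Fin n → Fin t₁}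
    {σ y : X → Fin n → ℝ} (hh : Continuous h) (hσ : Continuous σ) (hy : Continuous y) :
    Continuous fun p => (sparseEmbedding (h p) (σ p)).mulVec (y p) := by
  refine continuous_pi fun r => ?_
  simp only [sparseEmbedding_mulVec]
  refine continuous_finsetSum _ fun i _ => ?_
  have h1 : Continuous fun k : Fin t₁ => if k = r then (1 : ℝ) else 0 := continuous_of_discreteTopology
  exact (h1.comp ((continuous_apply i).comp hh)).mul
    (((continuous_apply i).comp hσ).mul ((continuous_apply i).comp hy))

theorem continuous_scaledMatrix_mulVec {X : Type*} [TopologicalSpace X]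
    {g : X → Fin t₂ → Fin t₁ → ℝ} {y : X → Fin t₁ → ℝ} (hg : Continuous g) (hy : Continuous y) :
    Continuous fun p => (scaledMatrix (g p)).mulVec (y p) := by
  refine continuous_pi fun r => ?_
  simp only [scaledMatrix, Matrix.mulVec, dotProduct, Matrix.smul_apply, Matrix.of_apply,
    smul_eq_mul]
  refine continuous_finsetSum _ fun i _ => ?_
  have h1 : Continuous fun p => g p r i :=
    (continuous_apply i).comp ((continuous_apply r).comp hg)
  exact (continuous_const.mul h1).mul ((continuous_apply i).comp hy)

/-- The union over `x` is uncountable, but each piece is given by strict inequalities between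
continuous functions, so the union is open. -/
theorem measurableSet_sparseFailure : MeasurableSet (sparseFailure A t₁) := by
  refine IsOpen.measurableSet ?_
  simp only [sparseFailure, Set.ofPred_exists]
  refine isOpen_iUnion fun x => ?_
  have c1 : Continuous fun p : (Fin n → ℝ) × (Fin n → ℝ) × (Fin n → Fin t₁) =>
      reweighted A p.1 x := continuous_reweighted continuous_fst x
  have c2 : Continuous fun p : (Fin n → ℝ) × (Fin n → ℝ) × (Fin n → Fin t₁) =>
      (sparseEmbedding p.2.2 p.2.1).mulVec (reweighted A p.1 x) :=
    continuous_sparseEmbedding_mulVec (by fun_prop) (by fun_prop) c1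
  have d1 := ((PiLp.continuous_toLp 2 _).comp c1).norm
  have d2 := ((PiLp.continuous_toLp 2 _).comp c2).norm
  exact (isOpen_lt (continuous_const.mul d1) d2).union (isOpen_lt d2 (continuous_const.mul d1))

theorem measurableSet_gaussianFailure : MeasurableSet (gaussianFailure A t₁ t₂) := by
  refine IsOpen.measurableSet ?_
  simp only [gaussianFailure, Set.ofPred_exists]
  refine isOpen_iUnion fun x => ?_
  have c1 : Continuous fun p : (Fin n → ℝ) × (Fin n → ℝ) × (Fin n → Fin t₁) ×
      (Fin t₂ → Fin t₁ → ℝ) => (sparseEmbedding p.2.2.1 p.2.1).mulVec (reweighted A p.1 x) :=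
    continuous_sparseEmbedding_mulVec (by fun_prop) (by fun_prop)
      (continuous_reweighted continuous_fst x)
  have c2 : Continuous fun p : (Fin n → ℝ) × (Fin n → ℝ) × (Fin n → Fin t₁) ×
      (Fin t₂ → Fin t₁ → ℝ) => (scaledMatrix p.2.2.2).mulVec
        ((sparseEmbedding p.2.2.1 p.2.1).mulVec (reweighted A p.1 x)) :=
    continuous_scaledMatrix_mulVec (by fun_prop) c1
  have d1 := ((PiLp.continuous_toLp 2 _).comp c1).norm
  have d2 := ((PiLp.continuous_toLp 2 _).comp c2).norm
  exact (isOpen_lt (continuous_const.mul d1) d2).union (isOpen_lt d2 (continuous_const.mul d1))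

variable {Ω : Type*} [MeasurableSpace Ω] {μ : Measure Ω} [IsProbabilityMeasure μ] {G : ℝ → ℝ}
  {u σ : Fin n → Ω → ℝ} {h : Fin n → Ω → Fin t₁} {g : Fin t₂ → Fin t₁ → Ω → ℝ}

/-- With the weights frozen, the subspace `D⁻¹A` is fixed, and independence integrates the bound
over the weights. -/
theorem measure_sparseFailure_le (hs : IsSketchSample G μ u σ h g) (hd : 1 ≤ d)
    (ht : 400 * (d : ℝ) ^ 2 ≤ t₁) :
    μ.real {ω | ((fun i => (u i ω)⁻¹), (fun i => σ i ω), fun i => h i ω) ∈ sparseFailure A t₁} ≤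
      1 / 100 := by
  have hmu := hs.measurable_u
  have hmσ := hs.measurable_σ
  have hmh := hs.measurable_h
  have hind : IndepFun (fun ω i => (u i ω)⁻¹) (fun ω => ((fun i => σ i ω), fun i => h i ω)) μ :=
    hs.indep_u_rest.comp (φ := fun (v : Fin n → ℝ) i => (v i)⁻¹)
      (ψ := fun p : (Fin n → ℝ) × (Fin n → Fin t₁) × (Fin t₂ → Fin t₁ → ℝ) => (p.1, p.2.1))
      (by fun_prop) (by fun_prop)
  have hσh : IndepFun (fun ω i => σ i ω) (fun ω i => h i ω) μ :=
    hs.indep_σ_rest.comp (φ := id) (ψ := Prod.fst) measurable_id measurable_fst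
  refine hind.measureReal_le_of_forall (by fun_prop) (by fun_prop) measurableSet_sparseFailure
    fun v => ?_
  have := sparseEmbedding_subspace hs.measurable_σ hs.law_σ hs.indep_σ hs.measurable_h hs.law_h
    hs.indep_h hσh hd ht (Matrix.diagonal v * A)
  simp only [mulVec_diagonal_mul] at this
  exact this

/-- Weights, signs and hash values are frozen one after the other, following the nested form of the
independence hypotheses; each time a fibre of the failure set remains. -/
theorem measure_gaussianFailure_le (hs : IsSketchSample G μ u σ h g) (hd : 1 ≤ d)
    (ht : 80 * (d : ℝ) ≤ t₂) :
    μ.real {ω | ((fun i => (u i ω)⁻¹), (fun i => σ i ω), (fun i => h i ω), fun a b => g a b ω) ∈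
      gaussianFailure A t₁ t₂} ≤ 1 / 100 := by
  have hmu := hs.measurable_u
  have hmσ := hs.measurable_σ
  have hmh := hs.measurable_h
  have hmg := hs.measurable_g
  have hg' : Measurable fun ω a b => g a b ω :=
    measurable_pi_lambda _ fun a => measurable_pi_lambda _ fun b => hmg a b
  have hB : MeasurableSet (gaussianFailure A t₁ t₂) := measurableSet_gaussianFailure
  have hind : IndepFun (fun ω i => (u i ω)⁻¹)
      (fun ω => ((fun i => σ i ω), (fun i => h i ω), fun a b => g a b ω)) μ :=
    hs.indep_u_rest.comp (φ := fun (v : Fin n → ℝ) i => (v i)⁻¹) (ψ := id) (by fun_prop) measurable_id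
  refine hind.measureReal_le_of_forall (by fun_prop) (by fun_prop) hB fun v => ?_
  refine hs.indep_σ_rest.measureReal_le_of_forall (B := Prod.mk v ⁻¹' gaussianFailure A t₁ t₂)
    (by fun_prop) (by fun_prop) (measurable_prodMk_left hB) fun s => ?_
  refine hs.indep_h_g.measureReal_le_of_forall
    (B := Prod.mk s ⁻¹' (Prod.mk v ⁻¹' gaussianFailure A t₁ t₂))
    (by fun_prop) (by fun_prop) (measurable_prodMk_left (measurable_prodMk_left hB)) fun k => ?_
  have := scaledMatrix_subspace hs.measurable_g hs.law_g hs.indep_g hd ht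
    (sparseEmbedding k s * (Matrix.diagonal v * A))
  have hW : ∀ x, (sparseEmbedding k s * (Matrix.diagonal v * A)).mulVec x =
      (sparseEmbedding k s).mulVec (reweighted A v x) := fun x => by
    rw [← Matrix.mulVec_mulVec, mulVec_diagonal_mul]
  simp only [hW] at this
  exact this

end Sketch

/-- The sketch `Π₂ Π₁ D⁻¹` embeds `d`-dimensional subspaces of the Orlicz space into `ℓ₂`. -/
theorem PropertyP.exists_sketch_bounds {G : ℝ → ℝ} (hG : PropertyP G) :
    ∃ Q : ℝ, 1 ≤ Q ∧ ∀ n d t₁ t₂ : ℕ, 2 ≤ n → 1 ≤ d → d ≤ n →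
        400 * (d : ℝ) ^ 2 ≤ (t₁ : ℝ) → 80 * (d : ℝ) ≤ (t₂ : ℝ) →
      ∀ (A : Matrix (Fin n) (Fin d) ℝ)
        (Ω : Type*) [MeasurableSpace Ω] (μ : Measure Ω) [IsProbabilityMeasure μ]
        (u : Fin n → Ω → ℝ) (σ : Fin n → Ω → ℝ) (h : Fin n → Ω → Fin t₁)
        (g : Fin t₂ → Fin t₁ → Ω → ℝ),
        IsSketchSample G μ u σ h g →
        (9 / 10 : ℝ) ≤ μ.real {ω | ∀ x : Fin d → ℝ,
          1 / (48 * 10 ^ 6) * (1 / (Q * d * Real.log n)) * orliczNorm G (A.mulVec x) ≤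
            ‖WithLp.toLp 2 ((scaledMatrix (fun a b => g a b ω) *
              sparseEmbedding (fun i => h i ω) (fun i => σ i ω) *
              (Matrix.diagonal fun i => u i ω)⁻¹ * A).mulVec x)‖ ∧
          ‖WithLp.toLp 2 ((scaledMatrix (fun a b => g a b ω) *
              sparseEmbedding (fun i => h i ω) (fun i => σ i ω) *
              (Matrix.diagonal fun i => u i ω)⁻¹ * A).mulVec x)‖ ≤
            12 * (Q * (d : ℝ) ^ 2 * Real.log n) * orliczNorm G (A.mulVec x)} := by
  obtain ⟨Q, hQ, H⟩ := hG.exists_reweighting_bounds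
  refine ⟨Q, hQ, ?_⟩
  intro n d t₁ t₂ hn hd hdn ht1 ht2 A Ω _ μ _ u σ h g hs
  have hl := half_le_log_natCast hn
  have h1 := H n d hn hd hdn A Ω μ u hs.measurable_u hs.law_u hs.indep_u
  have h2 := measure_sparseFailure_le (A := A) hs hd ht1
  have h3 := measure_gaussianFailure_le (A := A) hs hd ht2
  have h4 : μ.real {ω | ¬ ∀ i, 0 < u i ω} = 0 := by
    rw [measureReal_eq_zero_iff]
    exact ae_iff.1 (ae_weights_pos hG hs.law_u)
  set l := Real.log n
  set E := {ω | ∀ x : Fin d → ℝ, _ ∧ _} with hE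
  set B1 := {ω | ∃ x, ‖WithLp.toLp 2 (fun i => (u i ω)⁻¹ * A.mulVec x i)‖ < _ ∨ _}
  set B2 := {ω | ((fun i => (u i ω)⁻¹), (fun i => σ i ω), fun i => h i ω) ∈ sparseFailure A t₁}
  set B3 := {ω | ((fun i => (u i ω)⁻¹), (fun i => σ i ω), (fun i => h i ω), fun a b => g a b ω) ∈
      gaussianFailure A t₁ t₂}
  set B4 := {ω | ¬ ∀ i, 0 < u i ω}
  -- Covering the whole space bounds the measure of `E` from below by subadditivity, without
  -- measurability of `E`.
  have hcover : (Set.univ : Set Ω) ⊆ E ∪ (B1 ∪ (B2 ∪ (B3 ∪ B4))) := by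
    intro ω _
    by_contra hgood
    simp only [Set.mem_union, not_or] at hgood
    obtain ⟨g0, g1, g2, g3, g4⟩ := hgood
    refine g0 fun x => ?_
    simp only [B1, Set.mem_ofPred_eq, not_exists, not_or, not_lt] at g1
    simp only [B2, sparseFailure, Set.mem_ofPred_eq, not_exists, not_or, not_lt] at g2
    simp only [B3, gaussianFailure, Set.mem_ofPred_eq, not_exists, not_or, not_lt] at g3
    simp only [B4, Set.mem_ofPred_eq, not_not] at g4
    have g1 := g1 x
    have g2 := g2 x
    have g3 := g3 x
    rw [inv_diagonal_eq fun i => (g4 i).ne', Matrix.mul_assoc, ← Matrix.mulVec_mulVec,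
      mulVec_diagonal_mul, ← Matrix.mulVec_mulVec]
    change _ ≤ ‖WithLp.toLp 2 (reweighted A _ x)‖ ∧ ‖WithLp.toLp 2 (reweighted A _ x)‖ ≤ _ at g1
    -- The factors multiply: `8 * 2 * 3 = 48` for the lower bound, `2 * 2 * 3 = 12` for the upper
    -- one.
    have e1 : 1 / (48 * 10 ^ 6) * (1 / (Q * d * l)) * orliczNorm G (A.mulVec x) =
        1 / 6 * (1 / (8 * 10 ^ 6 * (Q * d * l)) * orliczNorm G (A.mulVec x)) := by
      field_simp; ring
    rw [e1]
    constructor <;> linarith [g1.1, g1.2, g2.1, g2.2, g3.1, g3.2]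
  have hu := measureReal_mono (μ := μ) hcover (measure_ne_top _ _)
  rw [probReal_univ] at hu
  have k1 := measureReal_union_le (μ := μ) E (B1 ∪ (B2 ∪ (B3 ∪ B4)))
  have k2 := measureReal_union_le (μ := μ) B1 (B2 ∪ (B3 ∪ B4))
  have k3 := measureReal_union_le (μ := μ) B2 (B3 ∪ B4)
  have k4 := measureReal_union_le (μ := μ) B3 B4
  linarith

/-! ### The program, its invariants and its step count -/

namespace RealRAM

/-- Started in `s`, the program halts after at most `B` steps in a state that satisfies `Q`. -/
def Runs (P : Program) (s : State) (B : ℕ) (Q : State → Prop) : Prop :=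
  ∃ (s' : State) (T : ℕ), Exec P s s' T ∧ T ≤ B ∧ Q s'

theorem Runs.mono {P : Program} {s : State} {B B' : ℕ} {Q Q' : State → Prop} (h : Runs P s B Q)
    (hB : B ≤ B') (hQ : ∀ s, Q s → Q' s) : Runs P s B' Q' := by
  obtain ⟨s', T, h1, h2, h3⟩ := h
  exact ⟨s', T, h1, h2.trans hB, hQ _ h3⟩

theorem Runs.seq {P P' : Program} {s : State} {B B' : ℕ} {Q : State → Prop}
    (h : Runs P s B fun s' => Runs P' s' B' Q) : Runs (.seq P P') s (B + B') Q := by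
  obtain ⟨s', T, h1, h2, s'', T', h3, h4, h5⟩ := h
  exact ⟨s'', T + T', .seq h1 h3, by omega, h5⟩

/-- A loop with a counter and an invariant. -/
theorem Runs.loop {c : Test} {P : Program} {B N : ℕ} (I : ℕ → State → Prop)
    (hstep : ∀ k < N, ∀ s, I k s → c.Holds s ∧ Runs P s B (I (k + 1)))
    (hend : ∀ s, I N s → ¬ c.Holds s) {s : State} (hs : I 0 s) :
    Runs (.loop c P) s (N * (B + 1) + 1) (I N) := by
  suffices H : ∀ m k, k + m = N → ∀ s, I k s → Runs (.loop c P) s (m * (B + 1) + 1) (I N) from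
    H N 0 (by omega) s hs
  intro m
  induction m with
  | zero =>
    intro k hk s hs
    obtain rfl : k = N := by omega
    exact ⟨s, 1, .loop_false (hend s hs), by omega, hs⟩
  | succ m ih =>
    intro k hk s hs
    obtain ⟨hc, s', T, h1, h2, h3⟩ := hstep k (by omega) s hs
    obtain ⟨s'', T', h4, h5, h6⟩ := ih (k + 1) (by omega) s' h3
    refine ⟨s'', T + T' + 1, .loop_true hc h1 h4, ?_, h6⟩
    rw [Nat.succ_mul]
    omega

/-- Straight-line programs. -/
def block : Instr → List Instr → Program
  | i, [] => .instr i
  | i, j :: l => .seq (.instr i) (block j l)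

/-- The effect of a list of instructions. -/
noncomputable def evalList : List Instr → State → State
  | [], s => s
  | i :: l, s => evalList l (i.eval s)

theorem Runs.block (i : Instr) (l : List Instr) {s : State} {Q : State → Prop}
    (h : Q (evalList (i :: l) s)) : Runs (block i l) s (l.length + 1) Q := by
  suffices H : ∀ (l : List Instr) (i : Instr) (s : State),
      Exec (RealRAM.block i l) s (evalList (i :: l) s) (l.length + 1) from
    ⟨_, _, H l i s, le_rfl, h⟩
  intro l
  induction l with
  | nil => intro i s; exact .instr i s
  | cons j l ih =>
    intro i s
    have := Exec.seq (.instr i s) (ih j (i.eval s))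
    rwa [add_comm] at this

/-- Tabulate the multiples of `d` in the natural array `3`. -/
def tableProgram : Program :=
  .seq (block (.nconst 5 1) [.nconst 6 0, .nconst 7 0])
    (.loop (.nlt 6 2) (block (.nstore 3 6 7) [.nadd 7 7 1, .nadd 6 6 5]))

/-- Accumulate the product of the sparse factors in the real array `5`. -/
def accumulateProgram : Program :=
  .seq (.instr (.nconst 8 0))
    (.loop (.nlt 8 4) (block (.nload 9 0 8) [.nload 10 1 8, .nload 11 2 9, .nload 12 3 11,
      .nadd 12 12 10, .rload 0 0 8, .rload 1 1 9, .rdiv 0 0 1, .rload 1 2 9, .rmul 0 0 1,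
      .rload 1 5 12, .radd 1 1 0, .rstore 5 12 1, .nadd 8 8 5]))

/-- The scalar product of a row of the dense factor and a column of the accumulated matrix. -/
def entryProgram : Program :=
  .seq (block (.rconst 2 0) [.nconst 17 0, .nadd 18 14 17, .nadd 19 16 17])
    (.loop (.nlt 17 2) (block (.rload 3 3 18) [.rload 4 5 19, .rmul 3 3 4, .radd 2 2 3,
      .nadd 18 18 5, .nadd 19 19 1, .nadd 17 17 5]))

/-- One row of the output. -/
def rowProgram : Program :=
  .seq (.instr (.nconst 16 0))
    (.loop (.nlt 16 1) (.seq entryProgram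
      (block (.rstore 4 13 2) [.nadd 13 13 5, .nadd 16 16 5])))

/-- The product of the dense factor and the accumulated matrix, in the real array `4`. -/
def multiplyProgram : Program :=
  .seq (block (.nconst 13 0) [.nconst 14 0, .nconst 15 0])
    (.loop (.nlt 15 3) (.seq rowProgram (block (.nadd 14 14 2) [.nadd 15 15 5])))

/-- The program for the sketch. -/
def sketchProgram : Program :=
  .seq tableProgram (.seq accumulateProgram multiplyProgram)

section Correctness

variable {d t₁ t₂ N : ℕ} {row col hash : ℕ → ℕ} {val u sgn M : ℕ → ℝ}

/-- The part of the state that is never changed. -/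
structure Fixed (d t₁ t₂ N : ℕ) (row col hash : ℕ → ℕ) (val u sgn M : ℕ → ℝ) (s : State) :
    Prop where
  d_eq : s.nreg 1 = d
  t₁_eq : s.nreg 2 = t₁
  t₂_eq : s.nreg 3 = t₂
  N_eq : s.nreg 4 = N
  row_eq : s.nmem 0 = row
  col_eq : s.nmem 1 = col
  hash_eq : s.nmem 2 = hash
  val_eq : s.rmem 0 = val
  u_eq : s.rmem 1 = u
  sgn_eq : s.rmem 2 = sgn
  M_eq : s.rmem 3 = M

/-- The accumulated matrix after the first `k` nonzero entries. -/
noncomputable def accumulated (d : ℕ) (row col hash : ℕ → ℕ) (val u sgn : ℕ → ℝ) (k m : ℕ) : ℝ :=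
  ∑ j ∈ Finset.range k,
    if m = hash (row j) * d + col j then val j / u (row j) * sgn (row j) else 0

/-- The state after the tabulation. -/
def Tabulated (d t₁ t₂ N : ℕ) (row col hash : ℕ → ℕ) (val u sgn M : ℕ → ℝ) (B : ℕ → ℝ)
    (r : ℕ) (s : State) : Prop :=
  Fixed d t₁ t₂ N row col hash val u sgn M s ∧ s.nreg 5 = 1 ∧ s.rmem 5 = B ∧
    ∀ i < r, s.nmem 3 i = i * d

/-- Row offsets `i * d` arise by repeated addition, as naturals cannot be multiplied in one step.
Register `5` keeps the constant `1` for all later increments. -/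
theorem runs_tableProgram {s : State} (hs : Fixed d t₁ t₂ N row col hash val u sgn M s)
    {B : ℕ → ℝ} (hB : s.rmem 5 = B) :
    Runs tableProgram s (3 + (t₁ * 4 + 1))
      (Tabulated d t₁ t₂ N row col hash val u sgn M B t₁) := by
  let I : ℕ → State → Prop := fun k s => Tabulated d t₁ t₂ N row col hash val u sgn M B k s ∧
    s.nreg 6 = k ∧ s.nreg 7 = k * d
  refine Runs.seq (Runs.block _ _ ?_)
  refine (Runs.loop (B := 3) (N := t₁) I ?_ ?_ ?_).mono le_rfl fun s h => h.1
  · rintro k hk s ⟨⟨hF, h5, hB, ht⟩, h6, h7⟩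
    refine ⟨by simp [Test.Holds, h6, hF.t₁_eq, hk], Runs.block _ _ ?_⟩
    obtain ⟨f1, f2, f3, f4, f5, f6, f7, f8, f9, f10, f11⟩ := hF
    refine ⟨⟨⟨?_, ?_, ?_, ?_, ?_, ?_, ?_, ?_, ?_, ?_, ?_⟩, ?_, ?_, ?_⟩, ?_, ?_⟩ <;>
      simp [evalList, Instr.eval, *]
    · intro i hi
      rcases eq_or_ne i k with rfl | hik
      · simp
      · simp [hik, ht i (by omega)]
    · ring
  · rintro s ⟨⟨hF, -⟩, h6, -⟩
    simp [Test.Holds, h6, hF.t₁_eq]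
  · obtain ⟨f1, f2, f3, f4, f5, f6, f7, f8, f9, f10, f11⟩ := hs
    refine ⟨⟨⟨?_, ?_, ?_, ?_, ?_, ?_, ?_, ?_, ?_, ?_, ?_⟩, ?_, ?_, ?_⟩, ?_, ?_⟩ <;>
      simp [evalList, Instr.eval, *]

/-- Fourteen instructions and one test per nonzero entry: this is the constant in front of `nnz`.
The accumulator starts as the zero array, so it needs no initialisation, and the hash bound keeps
lookups inside the table. -/
theorem runs_accumulateProgram (hhash : ∀ j < N, hash (row j) < t₁) {s : State}
    (hs : Tabulated d t₁ t₂ N row col hash val u sgn M 0 t₁ s) :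
    Runs accumulateProgram s (1 + (N * 15 + 1)) (Tabulated d t₁ t₂ N row col hash val u sgn M
      (accumulated d row col hash val u sgn N) t₁) := by
  let I : ℕ → State → Prop := fun k s => Tabulated d t₁ t₂ N row col hash val u sgn M
    (accumulated d row col hash val u sgn k) t₁ s ∧ s.nreg 8 = k
  refine Runs.seq (Runs.block (.nconst 8 0) [] ?_)
  refine (Runs.loop (B := 14) (N := N) I ?_ ?_ ?_).mono le_rfl fun s h => h.1
  · rintro k hk s ⟨⟨hF, h5, hB, ht⟩, h8⟩
    refine ⟨by simp [Test.Holds, h8, hF.N_eq, hk], Runs.block _ _ ?_⟩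
    obtain ⟨f1, f2, f3, f4, f5, f6, f7, f8, f9, f10, f11⟩ := hF
    have hk' := ht _ (hhash k hk)
    refine ⟨⟨⟨?_, ?_, ?_, ?_, ?_, ?_, ?_, ?_, ?_, ?_, ?_⟩, ?_, ?_, ?_⟩, ?_⟩
    -- The updated cell is exactly the one selected by the indicator in the new summand.
    case refine_13 =>
      funext m
      simp [evalList, Instr.eval, h8, f5, f6, f7, f8, f9, f10, hk', hB, accumulated,
        Finset.sum_range_succ, Function.update_apply]
      split_ifs <;> simp_all
    all_goals simp [evalList, Instr.eval, h8, h5, f1, f2, f3, f4, f5, f6, f7, f8, f9, f10, f11]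
    exact ht
  · rintro s ⟨⟨hF, -⟩, h8⟩
    simp [Test.Holds, h8, hF.N_eq]
  · obtain ⟨⟨f1, f2, f3, f4, f5, f6, f7, f8, f9, f10, f11⟩, h5, hB, ht⟩ := hs
    refine ⟨⟨⟨?_, ?_, ?_, ?_, ?_, ?_, ?_, ?_, ?_, ?_, ?_⟩, ?_, ?_, ?_⟩, ?_⟩ <;>
      simp [evalList, Instr.eval, *]
    · funext m
      simp [accumulated]
    · exact ht

/-- The entries of the product of the dense factor with a matrix stored in an array. -/
noncomputable def productEntry (d t₁ : ℕ) (M B : ℕ → ℝ) (a b : ℕ) : ℝ :=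
  ∑ r ∈ Finset.range t₁, M (a * t₁ + r) * B (r * d + b)

/-- The part of the state that the multiplication uses and never changes. -/
structure Operands (d t₁ t₂ : ℕ) (M B : ℕ → ℝ) (s : State) : Prop where
  d_eq : s.nreg 1 = d
  t₁_eq : s.nreg 2 = t₁
  t₂_eq : s.nreg 3 = t₂
  one_eq : s.nreg 5 = 1
  M_eq : s.rmem 3 = M
  B_eq : s.rmem 5 = B

/-- The state between the entries of the output: `(a, b)` is the position, `out` the content of
the output array. -/
def AtEntry (d t₁ t₂ : ℕ) (M B : ℕ → ℝ) (a b : ℕ) (out : ℕ → ℝ) (s : State) : Prop :=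
  Operands d t₁ t₂ M B s ∧ s.nreg 13 = a * d + b ∧ s.nreg 14 = a * t₁ ∧ s.nreg 15 = a ∧
    s.nreg 16 = b ∧ s.rmem 4 = out

/-- The invariant is the partial scalar product. Both addresses advance by addition: by `1` along a
row of the dense factor, by `d` down a column. -/
theorem runs_entryProgram {B : ℕ → ℝ} {a b : ℕ} {out : ℕ → ℝ} {s : State}
    (hs : AtEntry d t₁ t₂ M B a b out s) :
    Runs entryProgram s (4 + (t₁ * 8 + 1)) fun s =>
      AtEntry d t₁ t₂ M B a b out s ∧ s.rreg 2 = productEntry d t₁ M B a b := by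
  let I : ℕ → State → Prop := fun r s => AtEntry d t₁ t₂ M B a b out s ∧
    s.rreg 2 = ∑ i ∈ Finset.range r, M (a * t₁ + i) * B (i * d + b) ∧
    s.nreg 17 = r ∧ s.nreg 18 = a * t₁ + r ∧ s.nreg 19 = r * d + b
  refine Runs.seq (Runs.block _ _ ?_)
  refine (Runs.loop (B := 7) (N := t₁) I ?_ ?_ ?_).mono le_rfl fun s h => ⟨h.1, h.2.1⟩
  · rintro r hr s ⟨⟨hO, h13, h14, h15, h16, hout⟩, h2, h17, h18, h19⟩
    refine ⟨by simp [Test.Holds, h17, hO.t₁_eq, hr], Runs.block _ _ ?_⟩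
    obtain ⟨f1, f2, f3, f4, f5, f6⟩ := hO
    refine ⟨⟨⟨?_, ?_, ?_, ?_, ?_, ?_⟩, ?_, ?_, ?_, ?_, ?_⟩, ?_, ?_, ?_, ?_⟩ <;>
      simp [evalList, Instr.eval, *, Finset.sum_range_succ]
    · ring
    · ring
  · rintro s ⟨⟨hO, -⟩, -, h17, -⟩
    simp [Test.Holds, h17, hO.t₁_eq]
  · obtain ⟨⟨f1, f2, f3, f4, f5, f6⟩, h13, h14, h15, h16, hout⟩ := hs
    refine ⟨⟨⟨?_, ?_, ?_, ?_, ?_, ?_⟩, ?_, ?_, ?_, ?_, ?_⟩, ?_, ?_, ?_, ?_⟩ <;>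
      simp [evalList, Instr.eval, *]

/-- The state between the rows of the output. -/
def AtRow (d t₁ t₂ : ℕ) (M B : ℕ → ℝ) (a : ℕ) (s : State) : Prop :=
  Operands d t₁ t₂ M B s ∧ s.nreg 13 = a * d ∧ s.nreg 14 = a * t₁ ∧ s.nreg 15 = a ∧
    ∀ i < a, ∀ j < d, s.rmem 4 (i * d + j) = productEntry d t₁ M B i j

theorem runs_rowProgram {B : ℕ → ℝ} {a : ℕ} {s : State} (hs : AtRow d t₁ t₂ M B a s) :
    Runs rowProgram s (1 + (d * (4 + (t₁ * 8 + 1) + 3 + 1) + 1)) fun s =>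
      ∃ out, AtEntry d t₁ t₂ M B a d out s ∧
        ∀ i < a + 1, ∀ j < d, out (i * d + j) = productEntry d t₁ M B i j := by
  let I : ℕ → State → Prop := fun b s => ∃ out, AtEntry d t₁ t₂ M B a b out s ∧
    (∀ i < a, ∀ j < d, out (i * d + j) = productEntry d t₁ M B i j) ∧
    ∀ j < b, out (a * d + j) = productEntry d t₁ M B a j
  refine Runs.seq (Runs.block (.nconst 16 0) [] ?_)
  refine (Runs.loop (N := d) I ?_ ?_ ?_).mono le_rfl ?_
  · rintro b hb s ⟨out, hA, h1, h2⟩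
    refine ⟨by simp [Test.Holds, hA.1.d_eq, hA.2.2.2.2.1, hb], Runs.seq ?_⟩
    refine (runs_entryProgram hA).mono le_rfl ?_
    rintro s ⟨⟨hO, h13, h14, h15, h16, hout⟩, hr2⟩
    refine Runs.block _ _ ?_
    obtain ⟨f1, f2, f3, f4, f5, f6⟩ := hO
    refine ⟨Function.update out (a * d + b) (productEntry d t₁ M B a b),
      ⟨⟨?_, ?_, ?_, ?_, ?_, ?_⟩, ?_, ?_, ?_, ?_, ?_⟩, ?_, ?_⟩
    iterate 11 simp [evalList, Instr.eval, *, add_assoc]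
    · intro i hi j hj
      -- Writing in row `a` leaves earlier rows intact, since their addresses stay below `a * d`.
      have : i * d + j ≠ a * d + b := by
        have : (i + 1) * d ≤ a * d := Nat.mul_le_mul_right d hi
        rw [Nat.succ_mul] at this
        omega
      rw [Function.update_of_ne this, h1 i hi j hj]
    · intro j hj
      rcases eq_or_ne j b with rfl | hjb
      · simp
      · rw [Function.update_of_ne (by omega), h2 j (by omega)]
  · rintro s ⟨out, hA, -⟩
    simp [Test.Holds, hA.1.d_eq, hA.2.2.2.2.1]
  · obtain ⟨⟨f1, f2, f3, f4, f5, f6⟩, h13, h14, h15, hout⟩ := hs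
    refine ⟨s.rmem 4, ⟨⟨?_, ?_, ?_, ?_, ?_, ?_⟩, ?_, ?_, ?_, ?_, ?_⟩, hout, by simp⟩ <;>
      simp [evalList, Instr.eval, *]
  · rintro s ⟨out, hA, h1, h2⟩
    refine ⟨out, hA, fun i hi j hj => ?_⟩
    rcases Nat.lt_succ_iff_lt_or_eq.1 hi with h | rfl
    · exact h1 i h j hj
    · exact h2 j hj

theorem runs_multiplyProgram {B : ℕ → ℝ} {s : State} (hs : Operands d t₁ t₂ M B s) :
    Runs multiplyProgram s
      (3 + (t₂ * ((1 + (d * (4 + (t₁ * 8 + 1) + 3 + 1) + 1)) + 2 + 1) + 1))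
      (AtRow d t₁ t₂ M B t₂) := by
  refine Runs.seq (Runs.block _ _ ?_)
  refine Runs.loop (N := t₂) (fun a => AtRow d t₁ t₂ M B a) ?_ ?_ ?_
  · rintro a ha s hA
    refine ⟨by simp [Test.Holds, hA.1.t₂_eq, hA.2.2.2.1, ha], Runs.seq ?_⟩
    refine (runs_rowProgram hA).mono le_rfl ?_
    rintro s ⟨out, ⟨⟨f1, f2, f3, f4, f5, f6⟩, h13, h14, h15, h16, hout⟩, h1⟩
    refine Runs.block _ _ ?_
    refine ⟨⟨?_, ?_, ?_, ?_, ?_, ?_⟩, ?_, ?_, ?_, ?_⟩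
    iterate 9 simp [evalList, Instr.eval, *, Nat.succ_mul]
    simpa [evalList, Instr.eval, hout] using h1
  · rintro s hA
    simp [Test.Holds, hA.1.t₂_eq, hA.2.2.2.1]
  · obtain ⟨f1, f2, f3, f4, f5, f6⟩ := hs
    refine ⟨⟨?_, ?_, ?_, ?_, ?_, ?_⟩, ?_, ?_, ?_, ?_⟩ <;> simp [evalList, Instr.eval, *]

/-- The register holding `n` is never read, so the bound is free of `n`: beyond the pass over the
nonzero entries only `d`, `t₁`, `t₂` enter. -/
theorem runs_sketchProgram (hhash : ∀ j < N, hash (row j) < t₁) {s : State}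
    (hs : Fixed d t₁ t₂ N row col hash val u sgn M s) (hB : s.rmem 5 = 0) :
    Runs sketchProgram s (15 * N + (20 + 4 * t₁ + t₂ * (10 + d * (8 * t₁ + 10)))) fun s =>
      ∀ i < t₂, ∀ j < d, s.rmem 4 (i * d + j) =
        productEntry d t₁ M (accumulated d row col hash val u sgn N) i j := by
  have h := Runs.seq ((runs_tableProgram hs hB).mono le_rfl fun s hT =>
    Runs.seq ((runs_accumulateProgram hhash hT).mono le_rfl fun s hT =>
      runs_multiplyProgram (t₂ := t₂) ⟨hT.1.d_eq, hT.1.t₁_eq, hT.1.t₂_eq, hT.2.1, hT.1.M_eq,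
        hT.2.2.1⟩))
  refine h.mono ?_ fun s hA => hA.2.2.2.2
  have : d * (4 + (t₁ * 8 + 1) + 3 + 1) ≤ d * (8 * t₁ + 10) := Nat.mul_le_mul_left _ (by omega)
  have h2 : t₂ * ((1 + (d * (4 + (t₁ * 8 + 1) + 3 + 1) + 1)) + 2 + 1) ≤
      t₂ * (10 + d * (8 * t₁ + 10)) := Nat.mul_le_mul_left _ (by omega)
  omega

end Correctness

end RealRAM

/-! ### From array contents to matrix entries -/

theorem toArray_apply {α : Type*} [Zero α] {n : ℕ} (v : Fin n → α) (i : Fin n) :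
    toArray v i = v i := by
  simp [toArray]

theorem toRowMajor_apply {p q : ℕ} (M : Matrix (Fin p) (Fin q) ℝ) (a : Fin p) (r : Fin q) :
    toRowMajor M (a * q + r) = M a r := by
  have h := toArray_apply (fun k : Fin (p * q) =>
    M (finProdFinEquiv.symm k).1 (finProdFinEquiv.symm k).2) (finProdFinEquiv (a, r))
  rw [Equiv.symm_apply_apply] at h
  rw [toRowMajor, ← h]
  congr 1
  simp only [finProdFinEquiv_apply_val]
  ring

theorem mul_add_inj {d i i' j j' : ℕ} (hj : j < d) (hj' : j' < d) :
    i * d + j = i' * d + j' ↔ i = i' ∧ j = j' := by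
  refine ⟨fun h => ?_, by rintro ⟨rfl, rfl⟩; rfl⟩
  have hd : 0 < d := by omega
  have h1 := congrArg (· / d) h
  simp only [mul_comm _ d, Nat.mul_add_div hd, Nat.div_eq_of_lt hj, Nat.div_eq_of_lt hj',
    add_zero] at h1
  subst h1
  exact ⟨rfl, by omega⟩

section

variable {n d t₁ t₂ : ℕ} (A : Matrix (Fin n) (Fin d) ℝ)
  (e : Fin (nnz A) ≃ {p : Fin n × Fin d // A p.1 p.2 ≠ 0}) (u σ : Fin n → ℝ) (h : Fin n → Fin t₁)

/-- The order `e` is irrelevant to a sum, and zero entries of `A` may be added freely. Uniqueness of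
row-major addresses turns the address test into conditions on row and column. -/
theorem accumulated_eq (r : Fin t₁) (b : Fin d) :
    RealRAM.accumulated d (toArray fun k => ((e k).1.1 : ℕ)) (toArray fun k => ((e k).1.2 : ℕ))
      (toArray fun i => (h i : ℕ)) (toArray fun k => A (e k).1.1 (e k).1.2) (toArray u)
      (toArray σ) (nnz A) (r * d + b) =
    ∑ i, (if h i = r then 1 else 0) * σ i * ((u i)⁻¹ * A i b) := by
  rw [RealRAM.accumulated, Finset.sum_range]
  simp only [toArray_apply]
  let f : Fin n × Fin d → ℝ := fun p =>
    if (r : ℕ) * d + b = h p.1 * d + p.2 then A p.1 p.2 / u p.1 * σ p.1 else 0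
  change ∑ k, f (e k).1 = _
  have hf : ∀ p ∈ Finset.univ, f p ≠ 0 → A p.1 p.2 ≠ 0 := by
    intro p _ hp h0
    simp [f, h0] at hp
  rw [e.sum_comp (fun p => f p.1),
    ← Finset.sum_subtype (Finset.univ.filter fun p : Fin n × Fin d => A p.1 p.2 ≠ 0) (by simp) f,
    Finset.sum_filter_of_ne hf, Fintype.sum_prod_type]
  refine Finset.sum_congr rfl fun i _ => ?_
  have hiff : ∀ j : Fin d, ((r : ℕ) * d + b = h i * d + j) ↔ h i = r ∧ j = b := fun j => by
    rw [mul_add_inj b.isLt j.isLt, Fin.ext_iff, Fin.ext_iff, eq_comm, eq_comm (a := (b : ℕ))]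
  simp only [f, hiff, ite_and]
  split_ifs
  · simp only [Finset.sum_ite_eq', Finset.mem_univ, if_true]
    ring
  · simp

theorem productEntry_eq (hu : ∀ i, u i ≠ 0) (M : Matrix (Fin t₂) (Fin t₁) ℝ) (a : Fin t₂)
    (b : Fin d) :
    RealRAM.productEntry d t₁ (toRowMajor M) (RealRAM.accumulated d
      (toArray fun k => ((e k).1.1 : ℕ)) (toArray fun k => ((e k).1.2 : ℕ))
      (toArray fun i => (h i : ℕ)) (toArray fun k => A (e k).1.1 (e k).1.2) (toArray u)
      (toArray σ) (nnz A)) a b =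
    (M * sparseEmbedding h σ * (Matrix.diagonal u)⁻¹ * A) a b := by
  rw [RealRAM.productEntry, Finset.sum_range, inv_diagonal_eq hu, Matrix.mul_assoc,
    Matrix.mul_assoc, Matrix.mul_apply]
  refine Finset.sum_congr rfl fun r _ => ?_
  rw [toRowMajor_apply, accumulated_eq, Matrix.mul_apply]
  simp only [sparseEmbedding, Matrix.mul_diagonal, Matrix.diagonal_mul, Matrix.of_apply]

end

/-- The sketch can be computed in time `O(nnz A) + poly d`. -/
theorem exists_sketch_program :
    ∃ (P : RealRAM.Program) (K : ℕ), ∀ p : Polynomial ℕ, ∃ q : Polynomial ℕ,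
      ∀ (n d t₁ t₂ : ℕ), t₁ ≤ p.eval d → t₂ ≤ p.eval d →
      ∀ (A : Matrix (Fin n) (Fin d) ℝ)
        (e : Fin (nnz A) ≃ {p : Fin n × Fin d // A p.1 p.2 ≠ 0})
        (u : Fin n → ℝ) (σ : Fin n → ℝ) (h : Fin n → Fin t₁) (M : Matrix (Fin t₂) (Fin t₁) ℝ),
        (∀ i, u i ≠ 0) →
        ∃ (s : RealRAM.State) (T : ℕ),
          RealRAM.Exec P (sketchInput A e u σ h M) s T ∧
          T ≤ K * nnz A + q.eval d ∧
          ∀ (a : Fin t₂) (b : Fin d), s.rmem 4 ((a : ℕ) * d + b) =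
            (M * sparseEmbedding h σ * (Matrix.diagonal u)⁻¹ * A) a b := by
  -- The polynomial is the step bound with `p` in place of `t₁` and `t₂`; monotonicity over the
  -- naturals does the rest.
  refine ⟨RealRAM.sketchProgram, 15, fun p =>
    ⟨20 + 4 * p + p * (10 + Polynomial.X * (8 * p + 10)), ?_⟩⟩
  intro n d t₁ t₂ ht₁ ht₂ A e u σ h M hu
  have hfix : RealRAM.Fixed d t₁ t₂ (nnz A) (toArray fun k => ((e k).1.1 : ℕ))
      (toArray fun k => ((e k).1.2 : ℕ)) (toArray fun i => (h i : ℕ))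
      (toArray fun k => A (e k).1.1 (e k).1.2) (toArray u) (toArray σ) (toRowMajor M)
      (sketchInput A e u σ h M) :=
    ⟨rfl, rfl, rfl, rfl, rfl, rfl, rfl, rfl, rfl, rfl, rfl⟩
  obtain ⟨s, T, hE, hT, hs⟩ := RealRAM.runs_sketchProgram (fun j hj => by
    rw [toArray_apply (fun k => ((e k).1.1 : ℕ)) ⟨j, hj⟩, toArray_apply]
    exact (h _).isLt) hfix rfl
  refine ⟨s, T, hE, hT.trans ?_, fun a b => ?_⟩
  · simp only [Polynomial.eval_add, Polynomial.eval_mul, Polynomial.eval_X,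
      Polynomial.eval_ofNat]
    gcongr
  · rw [hs a a.isLt b b.isLt, productEntry_eq A e u σ h hu]

theorem theorem16 :
    (∃ c₁ c₂ κ₁ κ₂ : ℝ, 0 < c₁ ∧ 0 < c₂ ∧ 0 < κ₁ ∧ 0 < κ₂ ∧
      ∀ G : ℝ → ℝ, PropertyP G →
      ∃ α₁ α₂ : ℝ, 1 ≤ α₁ ∧ 1 ≤ α₂ ∧
      ∀ n d t₁ t₂ : ℕ, 2 ≤ n → 1 ≤ d → d ≤ n →
        c₁ * (d : ℝ) ^ 2 ≤ (t₁ : ℝ) → c₂ * (d : ℝ) ≤ (t₂ : ℝ) →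
      ∀ (A : Matrix (Fin n) (Fin d) ℝ)
        (Ω : Type*) [MeasurableSpace Ω] (μ : Measure Ω) [IsProbabilityMeasure μ]
        (u : Fin n → Ω → ℝ) (σ : Fin n → Ω → ℝ) (h : Fin n → Ω → Fin t₁)
        (g : Fin t₂ → Fin t₁ → Ω → ℝ),
        IsSketchSample G μ u σ h g →
        (9 / 10 : ℝ) ≤ μ.real {ω | ∀ x : Fin d → ℝ,
          κ₁ * (1 / (α₁ * d * Real.log n)) * orliczNorm G (A.mulVec x) ≤
            ‖WithLp.toLp 2 ((scaledMatrix (fun a b => g a b ω) *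
              sparseEmbedding (fun i => h i ω) (fun i => σ i ω) *
              (Matrix.diagonal fun i => u i ω)⁻¹ * A).mulVec x)‖ ∧
          ‖WithLp.toLp 2 ((scaledMatrix (fun a b => g a b ω) *
              sparseEmbedding (fun i => h i ω) (fun i => σ i ω) *
              (Matrix.diagonal fun i => u i ω)⁻¹ * A).mulVec x)‖ ≤
            κ₂ * (α₂ * (d : ℝ) ^ 2 * Real.log n) * orliczNorm G (A.mulVec x)}) ∧
    (∃ (P : RealRAM.Program) (K : ℕ), ∀ p : Polynomial ℕ, ∃ q : Polynomial ℕ,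
      ∀ (n d t₁ t₂ : ℕ), t₁ ≤ p.eval d → t₂ ≤ p.eval d →
      ∀ (A : Matrix (Fin n) (Fin d) ℝ)
        (e : Fin (nnz A) ≃ {p : Fin n × Fin d // A p.1 p.2 ≠ 0})
        (u : Fin n → ℝ) (σ : Fin n → ℝ) (h : Fin n → Fin t₁) (M : Matrix (Fin t₂) (Fin t₁) ℝ),
        (∀ i, u i ≠ 0) →
        ∃ (s : RealRAM.State) (T : ℕ),
          RealRAM.Exec P (sketchInput A e u σ h M) s T ∧
          T ≤ K * nnz A + q.eval d ∧
          ∀ (a : Fin t₂) (b : Fin d), s.rmem 4 ((a : ℕ) * d + b) =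
            (M * sparseEmbedding h σ * (Matrix.diagonal u)⁻¹ * A) a b) := by
  refine ⟨⟨400, 80, 1 / (48 * 10 ^ 6), 12, by norm_num, by norm_num, by norm_num, by norm_num,
    fun G hG => ?_⟩, exists_sketch_program⟩
  obtain ⟨Q, hQ, H⟩ := hG.exists_sketch_bounds
  -- One constant, linear in the growth constant of `G`, serves for both bounds.
  exact ⟨Q, Q, hQ, hQ, H⟩
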